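/- Let $n$ be a nonnegative integer. Consider the hexagon with all angles $120^\circ$ and with side lengths $2n,\,2n+3,\,2n,\,2n+3,\,2n,\,2n+3$ (in cyclic order; for $n=0$ this is an equilateral triangle of side $3$), subdivided into equilateral triangles of side $1$. On each of the three sides of length $2n+3$, remove from it the middle one of the $2n+3$ unit triangles of the hexagon that have an edge on this side. A rhombus tiling of the remaining region is a partition of its unit triangles into rhombi, where a rhombus is the union of two unit triangles with a common edge. Then the number of rhombus tilings of this region equals $$\big((n+2)_{2n}\big)^6\;\frac{\Big(\prod_{k=0}^{2n}k!\Big)^3\;\prod_{k=0}^{6n+2}k!}{\Big(\prod_{k=0}^{4n+2}k!\Big)^3}\;(n+1)^3(3n+1)(3n+2)^2,$$ where $(a)_m=a(a+1)\cdots(a+m-1)$ and $(a)_0=1$. -/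

import Mathlib

/-- A unit triangle of the triangular lattice. The integer pair `(x, y)` stands for the lattice
point `x • e₁ + y • e₂` of the plane, where `e₁, e₂` are unit vectors at an angle of `60°`.
The triangle with `up = true` has the corners `(x, y), (x + 1, y), (x, y + 1)`, the one with
`up = false` has the corners `(x + 1, y), (x, y + 1), (x + 1, y + 1)`; every unit triangle of the
lattice is exactly one of these. -/
@[ext]
structure UnitTriangle where
  x : ℤ
  y : ℤ
  up : Bool
  deriving DecidableEq

namespace UnitTriangle

/-- The three corners of a unit triangle. -/
def corners (t : UnitTriangle) : Finset (ℤ × ℤ) :=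
  if t.up then {(t.x, t.y), (t.x + 1, t.y), (t.x, t.y + 1)}
  else {(t.x + 1, t.y), (t.x, t.y + 1), (t.x + 1, t.y + 1)}

/-- Two distinct unit triangles are adjacent if they have a common edge, that is, two common
corners. -/
def Adjacent (s t : UnitTriangle) : Prop :=
  s ≠ t ∧ (s.corners ∩ t.corners).card = 2

end UnitTriangle

/-- A (unit, lattice) rhombus consists of two unit triangles with a common edge. -/
def IsRhombus (R : Finset UnitTriangle) : Prop :=
  ∃ s t : UnitTriangle, s.Adjacent t ∧ R = {s, t}

/-- A rhombus tiling of a region (a set of unit triangles): a set of rhombi that lie in the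
region, such that each unit triangle of the region is covered by exactly one of them. -/
structure IsRhombusTiling (D : Set UnitTriangle) (T : Set (Finset UnitTriangle)) : Prop where
  isRhombus : ∀ R ∈ T, IsRhombus R
  subset : ∀ R ∈ T, ∀ t ∈ R, t ∈ D
  covers : ∀ t ∈ D, ∃! R : Finset UnitTriangle, R ∈ T ∧ t ∈ R

/-- The lattice points of the hexagon with angles `120°` and sides `p, q, p, q, p, q`. Its
vertices are, in cyclic order, `(p, 0), (p + q, 0), (p + q, p), (p, p + q), (0, p + q), (0, p)`:
the sides of length `q` lie on the lines `y = 0`, `x + y = 2 p + q`, `x = 0`, those of length `p`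
on the lines `x = p + q`, `y = p + q`, `x + y = p`. -/
def hexagonPoints (p q : ℕ) : Set (ℤ × ℤ) :=
  {v | 0 ≤ v.1 ∧ v.1 ≤ p + q ∧ 0 ≤ v.2 ∧ v.2 ≤ p + q ∧
    (p : ℤ) ≤ v.1 + v.2 ∧ v.1 + v.2 ≤ 2 * p + q}

/-- The hexagon with angles `120°` and sides `p, q, p, q, p, q`, as a set of unit triangles. -/
def hexagon (p q : ℕ) : Set UnitTriangle :=
  {t | ∀ v ∈ t.corners, v ∈ hexagonPoints p q}

/-- The middle ones of the `2 n + 3` unit triangles that have an edge on a given longer side of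
the hexagon with sides `2 n, 2 n + 3, 2 n, 2 n + 3, 2 n, 2 n + 3`, for the three longer sides
`y = 0` (from `(2 n, 0)` to `(4 n + 3, 0)`), `x = 0` (from `(0, 2 n)` to `(0, 4 n + 3)`) and
`x + y = 6 n + 3` (from `(4 n + 3, 2 n)` to `(2 n, 4 n + 3)`). -/
def middleTriangles (n : ℕ) : Set UnitTriangle :=
  {⟨3 * n + 1, 0, true⟩, ⟨0, 3 * n + 1, true⟩, ⟨3 * n + 1, 3 * n + 1, true⟩}

/-- The hexagon with sides `2 n, 2 n + 3, 2 n, 2 n + 3, 2 n, 2 n + 3` where the middle triangle is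
missing on each of the longer sides. -/
def incompleteHexagon (n : ℕ) : Set UnitTriangle :=
  hexagon (2 * n) (2 * n + 3) \ middleTriangles n

/-! The rows of triangles are processed from the bottom side upwards. An upward triangle whose lower
neighbour is gone pairs with one of its two neighbours in its row; a downward triangle left free in
that row pairs with the upward triangle above it. So the upward triangles that pair within their row
behave like particles: in each row a particle keeps its coordinate `x` or lowers it by one, and no
two collide. The `2 n + 2` particles start on the bottom side away from its middle; two are absorbed
directly below the other removed triangles, and `2 n` reach the top side. This is a
Lindström–Gessel–Viennot count, carried out one row at a time in `tilingCount_rowRegion`: a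
determinant is linear in each column, a particle's two choices add up in its column, and a collision
produces equal columns. Pascal's rule then yields the binomial determinant of
`tilingCount_incompleteHexagon`.

To evaluate it, the missing bottom position is restored as a column together with one more row, a
unit vector. The rows are now functionals `f ↦ Δ^x f (y)`, one for each removed triangle and each
unit of the top side, applied to the binomials `y.choose (2 n + j)` with `j < 2 n + 3`. These span
the polynomials of degree at most `4 n + 2` that vanish at `0, …, 2 n - 1`. Passing to the monic
basis `adaptedPoly`, which takes the zeros `4 n + 3, …, 6 n + 2` into account, costs a triangular
factor with diagonal `(2 n + j)!`. In the new basis the top side contributes a triangular block and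
vanishes on the last three basis elements.

Those three are a polynomial symmetric about `3 n + 1` times powers of `y - (3 n + 1)`. Hence the
remaining `3 × 3` block involves only the sums `centralSum`, and `centralSum_two` turns its
determinant into a multiple of a square. Signs are irrelevant because a count is nonnegative;
factorial arithmetic finishes the proof. -/

namespace UnitTriangle

/-! ### Adjacency of unit triangles in coordinates -/

/-- The upward unit triangle at `(x, y)`. -/
abbrev upAt (x y : ℤ) : UnitTriangle := ⟨x, y, true⟩

/-- The downward unit triangle at `(x, y)`. -/
abbrev downAt (x y : ℤ) : UnitTriangle := ⟨x, y, false⟩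

lemma Adjacent.symm {s t : UnitTriangle} (h : s.Adjacent t) : t.Adjacent s :=
  ⟨h.1.symm, by rw [Finset.inter_comm]; exact h.2⟩

lemma mem_corners_up {x y : ℤ} {v : ℤ × ℤ} : v ∈ (upAt x y).corners ↔
    (v.1 = x ∧ v.2 = y) ∨ (v.1 = x + 1 ∧ v.2 = y) ∨ (v.1 = x ∧ v.2 = y + 1) := by
  simp [corners, Prod.ext_iff]

lemma mem_corners_down {x y : ℤ} {v : ℤ × ℤ} : v ∈ (downAt x y).corners ↔
    (v.1 = x + 1 ∧ v.2 = y) ∨ (v.1 = x ∧ v.2 = y + 1) ∨ (v.1 = x + 1 ∧ v.2 = y + 1) := by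
  simp [corners, Prod.ext_iff]

/-- Reduces adjacency to linear conditions on integers, so that `omega` can settle which triangles
are neighbours. -/
lemma Adjacent.exists_corners {s t : UnitTriangle} (h : s.Adjacent t) :
    ∃ a b c d : ℤ, (a ≠ c ∨ b ≠ d) ∧ (a, b) ∈ s.corners ∧ (a, b) ∈ t.corners ∧
      (c, d) ∈ s.corners ∧ (c, d) ∈ t.corners := by
  obtain ⟨⟨a, b⟩, ⟨c, d⟩, hne, hs⟩ := Finset.card_eq_two.1 h.2
  have h1 : (a, b) ∈ s.corners ∩ t.corners := by rw [hs]; simp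
  have h2 : (c, d) ∈ s.corners ∩ t.corners := by rw [hs]; simp
  rw [Finset.mem_inter] at h1 h2
  refine ⟨a, b, c, d, ?_, h1.1, h1.2, h2.1, h2.2⟩
  by_contra! hc
  exact hne (by rw [hc.1, hc.2])

lemma adjacent_of_corners {s t : UnitTriangle} (h : s ≠ t) {u v : ℤ × ℤ} (huv : u ≠ v)
    (hst : ∀ w, w ∈ s.corners ∧ w ∈ t.corners ↔ w = u ∨ w = v) : s.Adjacent t := by
  refine ⟨h, ?_⟩
  have : s.corners ∩ t.corners = {u, v} := by
    ext w
    simpa using hst w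
  rw [this, Finset.card_pair huv]

lemma adjacent_up_down {x y a b : ℤ} : (upAt x y).Adjacent (downAt a b) ↔
    (a = x ∧ b = y) ∨ (a = x - 1 ∧ b = y) ∨ (a = x ∧ b = y - 1) := by
  constructor
  · intro h
    obtain ⟨u, v, u', v', hne, h1, h2, h3, h4⟩ := h.exists_corners
    rw [mem_corners_up] at h1 h3
    rw [mem_corners_down] at h2 h4
    dsimp only at h1 h2 h3 h4
    omega
  · rintro (⟨rfl, rfl⟩ | ⟨rfl, rfl⟩ | ⟨rfl, rfl⟩)
    · refine adjacent_of_corners (by simp) (u := (a + 1, b)) (v := (a, b + 1)) (by simp) ?_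
      rintro ⟨c, d⟩
      rw [mem_corners_up, mem_corners_down]
      simp only [Prod.mk.injEq]
      omega
    · refine adjacent_of_corners (by simp) (u := (x, b)) (v := (x, b + 1)) (by simp) ?_
      rintro ⟨c, d⟩
      rw [mem_corners_up, mem_corners_down]
      simp only [Prod.mk.injEq]
      omega
    · refine adjacent_of_corners (by simp) (u := (a, y)) (v := (a + 1, y)) (by simp) ?_
      rintro ⟨c, d⟩
      rw [mem_corners_up, mem_corners_down]
      simp only [Prod.mk.injEq]
      omega

lemma not_adjacent_up_up (x y a b : ℤ) : ¬ (upAt x y).Adjacent (upAt a b) := by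
  intro h
  have hne := h.1
  obtain ⟨u, v, u', v', hne', h1, h2, h3, h4⟩ := h.exists_corners
  rw [mem_corners_up] at h1 h2 h3 h4
  have : a ≠ x ∨ b ≠ y := by
    by_contra! hc
    exact hne (by rw [hc.1, hc.2])
  dsimp only at h1 h2 h3 h4
  omega

lemma not_adjacent_down_down (x y a b : ℤ) : ¬ (downAt x y).Adjacent (downAt a b) := by
  intro h
  have hne := h.1
  obtain ⟨u, v, u', v', hne', h1, h2, h3, h4⟩ := h.exists_corners
  rw [mem_corners_down] at h1 h2 h3 h4
  have : a ≠ x ∨ b ≠ y := by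
    by_contra! hc
    exact hne (by rw [hc.1, hc.2])
  dsimp only at h1 h2 h3 h4
  omega

end UnitTriangle

open UnitTriangle

/-! ### Counting tilings by removing one rhombus -/

/-- The number of rhombus tilings of a region. -/
noncomputable def tilingCount (D : Set UnitTriangle) : ℕ :=
  {T : Set (Finset UnitTriangle) | IsRhombusTiling D T}.ncard

lemma finite_tilings {D : Set UnitTriangle} (hD : D.Finite) :
    {T : Set (Finset UnitTriangle) | IsRhombusTiling D T}.Finite := by
  have h : {R : Finset UnitTriangle | (R : Set UnitTriangle) ⊆ D}.Finite :=
    hD.finite_subsets.preimage Finset.coe_injective.injOn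
  exact h.finite_subsets.subset fun T hT R hR t ht => hT.subset R hR t ht

lemma IsRhombusTiling.eq_of_mem {D : Set UnitTriangle} {T : Set (Finset UnitTriangle)}
    (h : IsRhombusTiling D T) {R R' : Finset UnitTriangle} {t : UnitTriangle} (hR : R ∈ T)
    (hR' : R' ∈ T) (ht : t ∈ R) (ht' : t ∈ R') : R = R' :=
  (h.covers t (h.subset R hR t ht)).unique ⟨hR, ht⟩ ⟨hR', ht'⟩

lemma IsRhombusTiling.insert {D : Set UnitTriangle} {T : Set (Finset UnitTriangle)}
    {s t : UnitTriangle} (hs : s ∈ D) (ht : t ∈ D) (hst : s.Adjacent t)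
    (h : IsRhombusTiling (D \ {s, t}) T) : IsRhombusTiling D (insert {s, t} T) := by
  constructor
  · rintro R (rfl | hR)
    · exact ⟨s, t, hst, rfl⟩
    · exact h.isRhombus R hR
  · rintro R (rfl | hR) u hu
    · simp only [Finset.mem_insert, Finset.mem_singleton] at hu
      rcases hu with rfl | rfl <;> assumption
    · exact (h.subset R hR u hu).1
  · intro u hu
    by_cases hust : u = s ∨ u = t
    · refine ⟨{s, t}, ⟨Set.mem_insert _ _, by simpa using hust⟩, ?_⟩
      rintro R ⟨rfl | hR, hRu⟩
      · rfl
      · exact absurd (by simpa using hust) (h.subset R hR u hRu).2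
    · obtain ⟨R, ⟨hR, hRu⟩, -⟩ := h.covers u ⟨hu, by simpa using hust⟩
      refine ⟨R, ⟨Set.mem_insert_of_mem _ hR, hRu⟩, ?_⟩
      rintro R' ⟨rfl | hR', hRu'⟩
      · exact absurd (by simpa using hRu') hust
      · exact h.eq_of_mem hR' hR hRu' hRu

lemma IsRhombusTiling.diff_singleton {D : Set UnitTriangle} {T : Set (Finset UnitTriangle)}
    {s t : UnitTriangle} (h : IsRhombusTiling D T) (hst : {s, t} ∈ T) :
    IsRhombusTiling (D \ {s, t}) (T \ {{s, t}}) := by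
  constructor
  · exact fun R hR => h.isRhombus R hR.1
  · intro R hR u hu
    refine ⟨h.subset R hR.1 u hu, fun hc => hR.2 ?_⟩
    exact h.eq_of_mem hR.1 hst hu (by simpa using hc)
  · rintro u ⟨hu, hust⟩
    obtain ⟨R, ⟨hR, hRu⟩, -⟩ := h.covers u hu
    refine ⟨R, ⟨⟨hR, ?_⟩, hRu⟩, ?_⟩
    · rintro rfl
      exact hust (by simpa using hRu)
    · rintro R' ⟨hR', hRu'⟩
      exact h.eq_of_mem hR'.1 hR hRu' hRu

lemma pair_notMem_of_tiling_diff {D : Set UnitTriangle} {T : Set (Finset UnitTriangle)}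
    {s t : UnitTriangle} (h : IsRhombusTiling (D \ {s, t}) T) : {s, t} ∉ T := fun hc =>
  (h.subset _ hc s (by simp)).2 (by simp)

/-- Adding and deleting the rhombus are inverse bijections; injectivity of adding it uses that no
tiling of the smaller region contains it. -/
lemma ncard_tilings_with_pair {D : Set UnitTriangle} {s t : UnitTriangle} (hs : s ∈ D)
    (ht : t ∈ D) (hst : s.Adjacent t) :
    {T | IsRhombusTiling D T ∧ {s, t} ∈ T}.ncard = tilingCount (D \ {s, t}) := by
  have himg : {T | IsRhombusTiling D T ∧ {s, t} ∈ T} =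
      (fun T => insert {s, t} T) '' {T | IsRhombusTiling (D \ {s, t}) T} := by
    ext T
    constructor
    · rintro ⟨hT, hmem⟩
      exact ⟨T \ {{s, t}}, hT.diff_singleton hmem, by simp [Set.insert_eq_of_mem hmem]⟩
    · rintro ⟨T', hT', rfl⟩
      exact ⟨IsRhombusTiling.insert hs ht hst hT', Set.mem_insert _ _⟩
  rw [himg, Set.InjOn.ncard_image, tilingCount]
  intro T hT T' hT' hTT'
  have h1 := pair_notMem_of_tiling_diff hT
  have h2 := pair_notMem_of_tiling_diff hT'
  have := congrArg (fun A => A \ {({s, t} : Finset UnitTriangle)}) hTT'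
  simpa [h1, h2] using this

/-- The tilings of a region are sorted by the rhombus that covers a given triangle. -/
lemma tilingCount_eq_sum {D : Set UnitTriangle} (hD : D.Finite) {t : UnitTriangle} (ht : t ∈ D)
    (S : Finset UnitTriangle) (hS : ∀ s, s ∈ S ↔ s ∈ D ∧ t.Adjacent s) :
    tilingCount D = ∑ s ∈ S, tilingCount (D \ {s, t}) := by
  have hun : {T | IsRhombusTiling D T} =
      ⋃ s ∈ (S : Set UnitTriangle), {T | IsRhombusTiling D T ∧ {s, t} ∈ T} := by
    ext T
    simp only [Set.mem_iUnion, Set.mem_ofPred_eq, exists_prop, Finset.mem_coe]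
    constructor
    · intro hT
      obtain ⟨R, ⟨hR, hRt⟩, -⟩ := hT.covers t ht
      obtain ⟨a, b, hab, rfl⟩ := hT.isRhombus R hR
      have ha := hT.subset _ hR a (by simp)
      have hb := hT.subset _ hR b (by simp)
      simp only [Finset.mem_insert, Finset.mem_singleton] at hRt
      rcases hRt with rfl | rfl
      · exact ⟨b, (hS b).2 ⟨hb, hab⟩, hT, by rwa [Finset.pair_comm]⟩
      · exact ⟨a, (hS a).2 ⟨ha, hab.symm⟩, hT, hR⟩
    · rintro ⟨s, -, hT, -⟩
      exact hT
  have hfin : ∀ s, {T | IsRhombusTiling D T ∧ {s, t} ∈ T}.Finite := fun s =>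
    (finite_tilings hD).subset fun T hT => hT.1
  have hdisj : (S : Set UnitTriangle).PairwiseDisjoint
      fun s => {T | IsRhombusTiling D T ∧ {s, t} ∈ T} := by
    intro s hs s' hs' hne
    refine Set.disjoint_left.2 ?_
    rintro T ⟨hT, h1⟩ ⟨-, h2⟩
    have heq := hT.eq_of_mem h1 h2 (t := t) (by simp) (by simp)
    have hmem : s ∈ ({s', t} : Finset UnitTriangle) := heq ▸ (by simp)
    simp only [Finset.mem_insert, Finset.mem_singleton] at hmem
    rcases hmem with h | h
    · exact hne h
    · exact ((hS s).1 hs).2.1 h.symm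
  have henc := S.finite_toSet.encard_biUnion hdisj
  rw [← hun, finsum_mem_coe_finset, ← (finite_tilings hD).cast_ncard_eq] at henc
  have hsum : ∑ s ∈ S, {T | IsRhombusTiling D T ∧ {s, t} ∈ T}.encard =
      ((∑ s ∈ S, tilingCount (D \ {s, t}) : ℕ) : ℕ∞) := by
    push_cast
    refine Finset.sum_congr rfl fun s hs => ?_
    rw [← (hfin s).cast_ncard_eq, ncard_tilings_with_pair ((hS s).1 hs).1 ht ((hS s).1 hs).2.symm]
  rw [hsum] at henc
  exact_mod_cast henc

lemma tilingCount_empty : tilingCount ∅ = 1 := by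
  rw [tilingCount, Set.ncard_eq_one]
  refine ⟨∅, ?_⟩
  ext T
  simp only [Set.mem_ofPred_eq, Set.mem_singleton_iff]
  constructor
  · intro hT
    refine Set.eq_empty_of_forall_notMem fun R hR => ?_
    obtain ⟨a, b, -, rfl⟩ := hT.isRhombus R hR
    exact hT.subset _ hR a (by simp)
  · rintro rfl
    constructor <;> simp

open Classical in
/-- Peeling off an upward triangle whose lower neighbour does not belong to the region. -/
lemma tilingCount_peel_up {D : Set UnitTriangle} (hD : D.Finite) {x y : ℤ} (ht : upAt x y ∈ D)
    (hlow : downAt x (y - 1) ∉ D) :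
    tilingCount D = (if downAt x y ∈ D then tilingCount (D \ {downAt x y, upAt x y}) else 0) +
      (if downAt (x - 1) y ∈ D then tilingCount (D \ {downAt (x - 1) y, upAt x y}) else 0) := by
  rw [tilingCount_eq_sum hD ht
    (({downAt x y, downAt (x - 1) y} : Finset UnitTriangle).filter (· ∈ D)), Finset.sum_filter,
    Finset.sum_pair (by rw [Ne, UnitTriangle.mk.injEq]; omega)]
  rintro ⟨a, b, c⟩
  cases c
  · simp only [Finset.mem_filter, Finset.mem_insert, Finset.mem_singleton, UnitTriangle.mk.injEq,
      and_true, adjacent_up_down]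
    constructor
    · rintro ⟨h, hd⟩
      exact ⟨hd, by tauto⟩
    · rintro ⟨hd, h | h | ⟨rfl, rfl⟩⟩
      · exact ⟨Or.inl h, hd⟩
      · exact ⟨Or.inr h, hd⟩
      · exact absurd hd hlow
  · simpa using fun _ => not_adjacent_up_up x y a b

open Classical in
/-- Peeling off a downward triangle whose two neighbours in the same row do not belong to the
region. -/
lemma tilingCount_peel_down {D : Set UnitTriangle} (hD : D.Finite) {x y : ℤ}
    (ht : downAt x y ∈ D) (h1 : upAt x y ∉ D) (h2 : upAt (x + 1) y ∉ D) :
    tilingCount D =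
      if upAt x (y + 1) ∈ D then tilingCount (D \ {upAt x (y + 1), downAt x y}) else 0 := by
  rw [tilingCount_eq_sum hD ht
    (({upAt x (y + 1)} : Finset UnitTriangle).filter (· ∈ D)), Finset.sum_filter,
    Finset.sum_singleton]
  rintro ⟨a, b, c⟩
  cases c
  · simpa using fun _ => not_adjacent_down_down x y a b
  · have hadj : (downAt x y).Adjacent (upAt a b) ↔
        (x = a ∧ y = b) ∨ (x = a - 1 ∧ y = b) ∨ (x = a ∧ y = b - 1) :=
      ⟨fun h => adjacent_up_down.1 h.symm, fun h => (adjacent_up_down.2 h).symm⟩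
    simp only [Finset.mem_filter, Finset.mem_singleton, UnitTriangle.mk.injEq, and_true, hadj]
    constructor
    · rintro ⟨h, hd⟩
      exact ⟨hd, by omega⟩
    · rintro ⟨hd, ⟨rfl, rfl⟩ | ⟨rfl, rfl⟩ | h⟩
      · exact absurd hd h1
      · exact absurd (by simpa using hd) h2
      · exact ⟨by omega, hd⟩

/-! ### Particles in one row and the transfer of determinants -/

/-- The triangles of the set `Z`, the downward triangles of the row `y` at positions in `Dn` that
are not taken by one of the first `i` particles, and the upward triangles of the row `y` at the
positions of the remaining particles. -/
def rowRegion (Z : Set UnitTriangle) (Dn : Finset ℤ) (y : ℤ) {k : ℕ} (c : Fin k → ℤ) (i : ℕ) :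
    Set UnitTriangle :=
  {t | t ∈ Z ∨ (t.up = false ∧ t.y = y ∧ t.x ∈ Dn ∧ ∀ j : Fin k, j.val < i → t.x ≠ c j) ∨
    (t.up = true ∧ t.y = y ∧ ∃ j : Fin k, i ≤ j.val ∧ t.x = c j)}

lemma finite_rowRegion {Z : Set UnitTriangle} (hZ : Z.Finite) (Dn : Finset ℤ) (y : ℤ) {k : ℕ}
    (c : Fin k → ℤ) (i : ℕ) : (rowRegion Z Dn y c i).Finite := by
  have h1 : ((fun x => downAt x y) '' (Dn : Set ℤ)).Finite := Dn.finite_toSet.image _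
  have h2 : (Set.range fun j => upAt (c j) y).Finite := Set.finite_range _
  refine (hZ.union (h1.union h2)).subset ?_
  rintro ⟨a, b, u⟩ (h | ⟨rfl, rfl, h, -⟩ | ⟨rfl, rfl, j, -, rfl⟩)
  · exact Or.inl h
  · exact Or.inr (Or.inl ⟨a, h, rfl⟩)
  · exact Or.inr (Or.inr ⟨j, rfl⟩)

section RowRegion

variable {Z : Set UnitTriangle} {Dn : Finset ℤ} {y : ℤ} {k : ℕ} {c : Fin k → ℤ}

lemma downAt_mem_rowRegion (hZ : ∀ t ∈ Z, y < t.y) {i : ℕ} {x : ℤ} :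
    downAt x y ∈ rowRegion Z Dn y c i ↔ x ∈ Dn ∧ ∀ j : Fin k, j.val < i → x ≠ c j := by
  have : downAt x y ∉ Z := fun h => lt_irrefl _ (hZ _ h)
  simp [rowRegion, this]

lemma rowRegion_diff_stay (hZ : ∀ t ∈ Z, y < t.y) (hc : StrictMono c) (i : Fin k) :
    rowRegion Z Dn y c i \ {downAt (c i) y, upAt (c i) y} = rowRegion Z Dn y c (i + 1) := by
  ext ⟨a, b, u⟩
  have hZ' : ∀ x u, (⟨x, y, u⟩ : UnitTriangle) ∉ Z := fun x u h => lt_irrefl _ (hZ _ h)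
  by_cases hb : b = y
  · subst hb
    cases u
    · simp only [rowRegion, Set.mem_sdiff, Set.mem_ofPred_eq, hZ', Set.mem_insert_iff,
        Set.mem_singleton_iff, UnitTriangle.mk.injEq, true_and, false_or, and_true, and_false,
        or_false, reduceCtorEq, false_and]
      constructor
      · rintro ⟨⟨h1, h2⟩, h3⟩
        refine ⟨h1, fun j hj => ?_⟩
        rcases Nat.lt_succ_iff_lt_or_eq.1 hj with h | h
        · exact h2 j h
        · rwa [Fin.ext h]
      · rintro ⟨h1, h2⟩
        exact ⟨⟨h1, fun j hj => h2 j (by omega)⟩, h2 i (by omega)⟩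
    · simp only [rowRegion, Set.mem_sdiff, Set.mem_ofPred_eq, hZ', Set.mem_insert_iff,
        Set.mem_singleton_iff, UnitTriangle.mk.injEq, true_and, false_or, and_true, and_false,
        reduceCtorEq, false_and]
      constructor
      · rintro ⟨⟨j, h1, rfl⟩, h3⟩
        refine ⟨j, ?_, rfl⟩
        have : j ≠ i := fun h => h3 (by rw [h])
        have := Fin.val_ne_iff.2 this
        omega
      · rintro ⟨j, h1, rfl⟩
        refine ⟨⟨j, by omega, rfl⟩, fun h => ?_⟩
        rw [hc.injective h] at h1
        omega
  · simp [rowRegion, hb]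

lemma rowRegion_diff_move (hZ : ∀ t ∈ Z, y < t.y) (hc : StrictMono c) (i : Fin k) :
    rowRegion Z Dn y c i \ {downAt (c i - 1) y, upAt (c i) y} =
      rowRegion Z Dn y (Function.update c i (c i - 1)) (i + 1) := by
  ext ⟨a, b, u⟩
  have hZ' : ∀ x u, (⟨x, y, u⟩ : UnitTriangle) ∉ Z := fun x u h => lt_irrefl _ (hZ _ h)
  by_cases hb : b = y
  · subst hb
    cases u
    · simp only [rowRegion, Set.mem_sdiff, Set.mem_ofPred_eq, hZ', Set.mem_insert_iff,
        Set.mem_singleton_iff, UnitTriangle.mk.injEq, true_and, false_or, and_true, and_false,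
        or_false, reduceCtorEq, false_and]
      constructor
      · rintro ⟨⟨h1, h2⟩, h3⟩
        refine ⟨h1, fun j hj => ?_⟩
        rcases Nat.lt_succ_iff_lt_or_eq.1 hj with h | h
        · rw [Function.update_of_ne (Fin.val_ne_iff.1 h.ne)]
          exact h2 j h
        · rw [Fin.ext h, Function.update_self]
          exact h3
      · rintro ⟨h1, h2⟩
        refine ⟨⟨h1, fun j hj => ?_⟩, ?_⟩
        · have := h2 j (by omega)
          rwa [Function.update_of_ne (Fin.val_ne_iff.1 hj.ne)] at this
        · have := h2 i (by omega)
          rwa [Function.update_self] at this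
    · simp only [rowRegion, Set.mem_sdiff, Set.mem_ofPred_eq, hZ', Set.mem_insert_iff,
        Set.mem_singleton_iff, UnitTriangle.mk.injEq, true_and, false_or, and_true, and_false,
        reduceCtorEq, false_and]
      constructor
      · rintro ⟨⟨j, h1, rfl⟩, h3⟩
        have hj : j ≠ i := fun h => h3 (by rw [h])
        refine ⟨j, ?_, by rw [Function.update_of_ne hj]⟩
        have := Fin.val_ne_iff.2 hj
        omega
      · rintro ⟨j, h1, rfl⟩
        have hj : j ≠ i := Fin.val_ne_iff.1 (by omega)
        rw [Function.update_of_ne hj]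
        exact ⟨⟨j, by omega, rfl⟩, fun h => hj (hc.injective h)⟩
  · simp [rowRegion, hb]

/-- Positions are integers, so an earlier particle that is left of `c i` and not at `c i - 1` is
left of `c i - 1` as well. -/
lemma strictMono_update_sub_one (hc : StrictMono c) (i : Fin k)
    (h : ∀ j : Fin k, j.val < i.val → c i - 1 ≠ c j) :
    StrictMono (Function.update c i (c i - 1)) := by
  intro a b hab
  by_cases ha : a = i
  · subst ha
    rw [Function.update_self, Function.update_of_ne hab.ne']
    have := hc hab
    omega
  · rw [Function.update_of_ne ha]
    by_cases hb : b = i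
    · subst hb
      rw [Function.update_self]
      have h1 := hc hab
      have h2 := h a hab
      omega
    · rw [Function.update_of_ne hb]
      exact hc hab

/-- The transfer of a determinantal count through the particles of one row. -/
lemma tilingCount_rowRegion_aux (hZf : Z.Finite) (hZ : ∀ t ∈ Z, y < t.y) (w : Fin k → ℤ → ℚ)
    (hdet : ∀ b : Fin k → ℤ, StrictMono b → (∀ j, b j ∈ Dn) →
      (tilingCount (rowRegion Z Dn y b k) : ℚ) = (Matrix.of fun r j => w r (b j)).det)
    (d i : ℕ) (hi : i + d = k) (c : Fin k → ℤ) (hc : StrictMono c)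
    (hlt : ∀ j : Fin k, j.val < i → c j ∈ Dn)
    (hge : ∀ j : Fin k, i ≤ j.val → ∀ r, (c j ∉ Dn → w r (c j) = 0) ∧
      (c j - 1 ∉ Dn → w r (c j - 1) = 0)) :
    (tilingCount (rowRegion Z Dn y c i) : ℚ) =
      (Matrix.of fun r (j : Fin k) =>
        if j.val < i then w r (c j) else w r (c j) + w r (c j - 1)).det := by
  classical
  induction d generalizing i c with
  | zero =>
    obtain rfl : i = k := by omega
    rw [hdet c hc fun j => hlt j j.2]
    congr 1
    ext r j
    simp
  | succ d ih =>
    let i' : Fin k := ⟨i, by omega⟩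
    set A : Matrix (Fin k) (Fin k) ℚ := Matrix.of fun r (j : Fin k) =>
        if j.val < i then w r (c j) else w r (c j) + w r (c j - 1) with hA
    -- Column `i'` is the sum of the columns of the two choices of this particle, so linearity of
    -- the determinant mirrors the peeling recursion.
    have hsplit : A.det = (A.updateCol i' fun r => w r (c i')).det +
        (A.updateCol i' fun r => w r (c i' - 1)).det := by
      rw [← Matrix.det_updateCol_add]
      congr 1
      ext r j
      by_cases hj : j = i'
      · subst hj
        simp [hA, i']
      · rw [Matrix.updateCol_ne hj]
    have hup : upAt (c i') y ∈ rowRegion Z Dn y c i :=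
      Or.inr (Or.inr ⟨rfl, rfl, i', le_rfl, rfl⟩)
    have hlow : downAt (c i') (y - 1) ∉ rowRegion Z Dn y c i := by
      rintro (h | ⟨-, h, -⟩ | ⟨h, -⟩)
      · have : y < y - 1 := hZ _ h
        omega
      · have : y - 1 = y := h
        omega
      · exact absurd h (by simp)
    rw [tilingCount_peel_up (finite_rowRegion hZf Dn y c i) hup hlow, Nat.cast_add, hsplit]
    congr 1
    · rw [show (downAt (c i') y ∈ rowRegion Z Dn y c i) ↔ c i' ∈ Dn by
        rw [downAt_mem_rowRegion hZ]
        exact ⟨fun h => h.1, fun h => ⟨h, fun j hj => (hc (show j < i' from hj)).ne'⟩⟩]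
      split_ifs with hmem
      · have := rowRegion_diff_stay (Dn := Dn) hZ hc i'
        rw [show (i' : ℕ) = i from rfl] at this
        rw [this, ih (i + 1) (by omega) c hc]
        · congr 1
          ext r j
          by_cases hj : j = i'
          · subst hj
            simp [i']
          · rw [Matrix.updateCol_ne hj, hA]
            have : j.val ≠ i := Fin.val_ne_iff.2 hj
            simp only [Matrix.of_apply]
            congr 1
            rw [eq_iff_iff]
            omega
        · intro j hj
          rcases Nat.lt_succ_iff_lt_or_eq.1 hj with h | h
          · exact hlt j h
          · rwa [show j = i' from Fin.ext h]
        · exact fun j hj => hge j (by omega)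
      · rw [Nat.cast_zero, eq_comm]
        refine Matrix.det_eq_zero_of_column_eq_zero i' fun r => ?_
        rw [Matrix.updateCol_self]
        exact (hge i' le_rfl r).1 hmem
    · rw [downAt_mem_rowRegion hZ]
      split_ifs with hmem
      · have := rowRegion_diff_move (Dn := Dn) hZ hc i'
        rw [show (i' : ℕ) = i from rfl] at this
        rw [this, ih (i + 1) (by omega) _ (strictMono_update_sub_one hc i' hmem.2)]
        · congr 1
          ext r j
          by_cases hj : j = i'
          · subst hj
            simp [i']
          · rw [Matrix.updateCol_ne hj, hA]
            have : j.val ≠ i := Fin.val_ne_iff.2 hj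
            simp only [Matrix.of_apply, Function.update_of_ne hj]
            congr 1
            rw [eq_iff_iff]
            omega
        · intro j hj
          rcases Nat.lt_succ_iff_lt_or_eq.1 hj with h | h
          · rw [Function.update_of_ne (Fin.val_ne_iff.1 h.ne)]
            exact hlt j h
          · rw [show j = i' from Fin.ext h, Function.update_self]
            exact hmem.1
        · intro j hj
          rw [Function.update_of_ne (Fin.val_ne_iff.1 (by simp only [i']; omega))]
          exact hge j (by omega)
      · rw [Nat.cast_zero, eq_comm]
        -- The move is blocked either by an earlier particle, and then two columns agree, or because
        -- the site lies outside the row, and then the column is zero.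
        by_cases hDn : c i' - 1 ∈ Dn
        · have : ∃ j : Fin k, j.val < i ∧ c i' - 1 = c j := by
            by_contra! h
            exact hmem ⟨hDn, h⟩
          obtain ⟨j, hj, hcj⟩ := this
          have hne : j ≠ i' := Fin.val_ne_iff.1 hj.ne
          refine Matrix.det_zero_of_column_eq hne fun r => ?_
          rw [Matrix.updateCol_self, Matrix.updateCol_ne hne, hA, hcj]
          simp [hj]
        · refine Matrix.det_eq_zero_of_column_eq_zero i' fun r => ?_
          rw [Matrix.updateCol_self]
          exact (hge i' le_rfl r).2 hDn

/-- One row of the Lindström–Gessel–Viennot argument. The vanishing condition lets steps that leave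
the region be included in the sum without changing it. -/
lemma tilingCount_rowRegion (hZf : Z.Finite) (hZ : ∀ t ∈ Z, y < t.y) (w : Fin k → ℤ → ℚ)
    (hdet : ∀ b : Fin k → ℤ, StrictMono b → (∀ j, b j ∈ Dn) →
      (tilingCount (rowRegion Z Dn y b k) : ℚ) = (Matrix.of fun r j => w r (b j)).det)
    (hc : StrictMono c)
    (hw : ∀ j r, (c j ∉ Dn → w r (c j) = 0) ∧ (c j - 1 ∉ Dn → w r (c j - 1) = 0)) :
    (tilingCount (rowRegion Z Dn y c 0) : ℚ) =
      (Matrix.of fun r j => w r (c j) + w r (c j - 1)).det := by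
  have := tilingCount_rowRegion_aux hZf hZ w hdet k 0 (by omega) c hc (by simp)
    fun j _ r => hw j r
  simpa using this

end RowRegion

/-- Downward triangles at the positions `S` of the row `y`, whose neighbours in this row are
missing, have to be combined with the upward triangles above them. -/
lemma tilingCount_forced {Z : Set UnitTriangle} (hZf : Z.Finite) {y : ℤ} (hZ : ∀ t ∈ Z, y < t.y)
    (S : Finset ℤ) (hS : ∀ x ∈ S, upAt x (y + 1) ∈ Z) :
    tilingCount (Z ∪ (fun x => downAt x y) '' S) =
      tilingCount (Z \ (fun x => upAt x (y + 1)) '' S) := by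
  classical
  induction S using Finset.induction_on generalizing Z with
  | empty => simp
  | insert x S hx ih =>
    have hZ' : ∀ x u, (⟨x, y, u⟩ : UnitTriangle) ∉ Z := fun x u h => lt_irrefl _ (hZ _ h)
    have hfin : (Z ∪ (fun x => downAt x y) '' ((insert x S : Finset ℤ) : Set ℤ)).Finite :=
      hZf.union ((Finset.finite_toSet _).image _)
    rw [tilingCount_peel_down hfin (x := x) (y := y) (Or.inr ⟨x, by simp, rfl⟩)
      (by simp [hZ']) (by simp [hZ']), if_pos (Set.mem_union_left _ (hS x (by simp)))]
    have h1 : (Z ∪ (fun x => downAt x y) '' ((insert x S : Finset ℤ) : Set ℤ)) \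
        {upAt x (y + 1), downAt x y} =
        (Z \ {upAt x (y + 1)}) ∪ (fun x => downAt x y) '' (S : Set ℤ) := by
      ext t
      have h2 : downAt x y ∉ Z := hZ' _ _
      simp only [Set.mem_sdiff, Set.mem_union, Set.mem_image, Finset.mem_coe, Finset.mem_insert,
        Set.mem_insert_iff, Set.mem_singleton_iff]
      constructor
      · rintro ⟨h | ⟨a, rfl | ha, rfl⟩, ht⟩
        · exact Or.inl ⟨h, fun h' => ht (Or.inl h')⟩
        · exact absurd (Or.inr rfl) ht
        · exact Or.inr ⟨a, ha, rfl⟩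
      · rintro (⟨h, ht⟩ | ⟨a, ha, rfl⟩)
        · refine ⟨Or.inl h, ?_⟩
          rintro (h' | rfl)
          · exact ht h'
          · exact h2 h
        · refine ⟨Or.inr ⟨a, Or.inr ha, rfl⟩, ?_⟩
          simp only [UnitTriangle.mk.injEq, reduceCtorEq, and_false, and_true, false_or]
          rintro rfl
          exact hx ha
    rw [h1, ih (hZf.subset Set.sdiff_subset) fun t ht => hZ t ht.1]
    · congr 1
      ext t
      simp only [Set.mem_sdiff, Set.mem_image, Finset.mem_coe, Finset.mem_insert,
        Set.mem_singleton_iff, exists_eq_or_imp]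
      rw [eq_comm (a := t), not_or, and_assoc]
    · intro a ha
      refine ⟨hS a (by simp [ha]), ?_⟩
      simp only [Set.mem_singleton_iff, UnitTriangle.mk.injEq, and_true]
      rintro rfl
      exact hx ha

/-- A downward triangle all of whose neighbours are missing makes a tiling impossible. -/
lemma tilingCount_eq_zero {D : Set UnitTriangle} (hD : D.Finite) {x y : ℤ}
    (ht : downAt x y ∈ D) (h1 : upAt x y ∉ D) (h2 : upAt (x + 1) y ∉ D)
    (h3 : upAt x (y + 1) ∉ D) : tilingCount D = 0 := by
  rw [tilingCount_peel_down hD ht h1 h2, if_neg h3]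

/-! ### Binomial path weights and the rows of the hexagon -/

/-- The binomial coefficient `d.choose a`, extended by zero to negative `a`. -/
def intChoose (d : ℕ) (a : ℤ) : ℚ := if 0 ≤ a then (d.choose a.toNat : ℚ) else 0

lemma intChoose_of_neg (d : ℕ) {a : ℤ} (h : a < 0) : intChoose d a = 0 :=
  if_neg (not_le.2 h)

lemma intChoose_of_lt (d : ℕ) {a : ℤ} (h : (d : ℤ) < a) : intChoose d a = 0 := by
  rw [intChoose, if_pos (by omega), Nat.choose_eq_zero_of_lt (by omega), Nat.cast_zero]

lemma intChoose_natCast (d a : ℕ) : intChoose d a = d.choose a := by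
  simp [intChoose]

lemma intChoose_zero (a : ℤ) : intChoose 0 a = if a = 0 then 1 else 0 := by
  rcases lt_trichotomy a 0 with h | rfl | h
  · rw [intChoose_of_neg 0 h, if_neg h.ne]
  · simp [intChoose]
  · rw [intChoose_of_lt 0 (by simpa using h), if_neg h.ne']

lemma intChoose_succ (d : ℕ) (a : ℤ) :
    intChoose (d + 1) a = intChoose d a + intChoose d (a - 1) := by
  rcases lt_trichotomy a 0 with h | rfl | h
  · rw [intChoose_of_neg _ h, intChoose_of_neg _ h, intChoose_of_neg _ (by omega), add_zero]
  · rw [intChoose_of_neg d (by omega : (0 : ℤ) - 1 < 0)]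
    simp [intChoose]
  · obtain ⟨b, rfl⟩ : ∃ b : ℕ, a = (b + 1 : ℕ) := ⟨a.toNat - 1, by omega⟩
    rw [show (((b + 1 : ℕ) : ℤ) - 1) = (b : ℤ) by push_cast; ring]
    simp only [intChoose_natCast]
    rw [Nat.choose_succ_succ]
    push_cast
    ring

lemma upAt_mem_hexagon {p q : ℕ} {x y : ℤ} : upAt x y ∈ hexagon p q ↔
    0 ≤ x ∧ x + 1 ≤ p + q ∧ 0 ≤ y ∧ y + 1 ≤ p + q ∧ p ≤ x + y ∧ x + y + 1 ≤ 2 * p + q := by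
  constructor
  · intro h
    have h1 := h (x, y) (by rw [mem_corners_up]; simp)
    have h2 := h (x + 1, y) (by rw [mem_corners_up]; simp)
    have h3 := h (x, y + 1) (by rw [mem_corners_up]; simp)
    simp only [hexagonPoints, Set.mem_ofPred_eq] at h1 h2 h3
    omega
  · rintro h ⟨a, b⟩ hv
    rw [mem_corners_up] at hv
    simp only [hexagonPoints, Set.mem_ofPred_eq]
    dsimp only at hv
    omega

lemma downAt_mem_hexagon {p q : ℕ} {x y : ℤ} : downAt x y ∈ hexagon p q ↔
    0 ≤ x ∧ x + 1 ≤ p + q ∧ 0 ≤ y ∧ y + 1 ≤ p + q ∧ p ≤ x + y + 1 ∧ x + y + 2 ≤ 2 * p + q := by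
  constructor
  · intro h
    have h1 := h (x + 1, y) (by rw [mem_corners_down]; simp)
    have h2 := h (x, y + 1) (by rw [mem_corners_down]; simp)
    have h3 := h (x + 1, y + 1) (by rw [mem_corners_down]; simp)
    simp only [hexagonPoints, Set.mem_ofPred_eq] at h1 h2 h3
    omega
  · rintro h ⟨a, b⟩ hv
    rw [mem_corners_down] at hv
    simp only [hexagonPoints, Set.mem_ofPred_eq]
    dsimp only at hv
    omega

lemma upAt_mem_incompleteHexagon {n : ℕ} {x y : ℤ} : upAt x y ∈ incompleteHexagon n ↔
    (0 ≤ x ∧ x ≤ 4 * n + 2 ∧ 0 ≤ y ∧ y ≤ 4 * n + 2 ∧ 2 * n ≤ x + y ∧ x + y ≤ 6 * n + 2) ∧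
      ¬ (x = 3 * n + 1 ∧ y = 0) ∧ ¬ (x = 0 ∧ y = 3 * n + 1) ∧
      ¬ (x = 3 * n + 1 ∧ y = 3 * n + 1) := by
  simp only [incompleteHexagon, middleTriangles, Set.mem_sdiff, upAt_mem_hexagon,
    Set.mem_insert_iff, Set.mem_singleton_iff, UnitTriangle.mk.injEq, and_true]
  push_cast
  constructor <;> intro h <;> omega

lemma downAt_mem_incompleteHexagon {n : ℕ} {x y : ℤ} : downAt x y ∈ incompleteHexagon n ↔
    0 ≤ x ∧ x ≤ 4 * n + 2 ∧ 0 ≤ y ∧ y ≤ 4 * n + 2 ∧ 2 * n ≤ x + y + 1 ∧ x + y ≤ 6 * n + 1 := by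
  simp only [incompleteHexagon, middleTriangles, Set.mem_sdiff, downAt_mem_hexagon,
    Set.mem_insert_iff, Set.mem_singleton_iff, UnitTriangle.mk.injEq, reduceCtorEq, and_false,
    or_false, not_false_eq_true, and_true]
  push_cast
  constructor <;> intro h <;> omega

/-- The part of the incomplete hexagon above the row `y`. -/
def hexagonAbove (n : ℕ) (y : ℤ) : Set UnitTriangle := {t | t ∈ incompleteHexagon n ∧ y < t.y}

/-- The positions of the downward triangles in the row `y` of the incomplete hexagon. -/
noncomputable def downRow (n : ℕ) (y : ℤ) : Finset ℤ :=
  Finset.Icc (max 0 (2 * n - y - 1)) (min (4 * n + 2) (6 * n + 1 - y))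

lemma mem_downRow {n : ℕ} {x y : ℤ} : x ∈ downRow n y ↔
    0 ≤ x ∧ x ≤ 4 * n + 2 ∧ 2 * n ≤ x + y + 1 ∧ x + y ≤ 6 * n + 1 := by
  rw [downRow, Finset.mem_Icc]
  omega

lemma finite_incompleteHexagon (n : ℕ) : (incompleteHexagon n).Finite := by
  have h : ((fun v : ℤ × ℤ × Bool => (⟨v.1, v.2.1, v.2.2⟩ : UnitTriangle)) ''
      (Set.Icc 0 (4 * n + 2 : ℤ) ×ˢ (Set.Icc 0 (4 * n + 2 : ℤ) ×ˢ Set.univ))).Finite :=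
    ((Set.finite_Icc _ _).prod ((Set.finite_Icc _ _).prod Set.finite_univ)).image _
  refine h.subset ?_
  rintro ⟨x, y, u⟩ ht
  refine ⟨(x, y, u), ?_, rfl⟩
  simp only [Set.mem_prod, Set.mem_Icc, Set.mem_univ, and_true]
  cases u
  · have := downAt_mem_incompleteHexagon.1 ht
    omega
  · have := upAt_mem_incompleteHexagon.1 ht
    omega

lemma finite_hexagonAbove (n : ℕ) (y : ℤ) : (hexagonAbove n y).Finite :=
  (finite_incompleteHexagon n).subset fun _ h => h.1

lemma lt_of_mem_hexagonAbove {n : ℕ} {y : ℤ} : ∀ t ∈ hexagonAbove n y, y < t.y :=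
  fun _ h => h.2

lemma mem_rowRegion_zero {Z : Set UnitTriangle} {Dn : Finset ℤ} {y : ℤ} {k : ℕ} {c : Fin k → ℤ}
    {t : UnitTriangle} : t ∈ rowRegion Z Dn y c 0 ↔ t ∈ Z ∨ (t.up = false ∧ t.y = y ∧ t.x ∈ Dn) ∨
      (t.up = true ∧ t.y = y ∧ ∃ j, t.x = c j) := by
  simp [rowRegion]

/-- Once every particle has been paired, only the unoccupied downward triangles of the row are left,
which is the situation of `tilingCount_forced`. -/
lemma rowRegion_last_eq {Z : Set UnitTriangle} {Dn : Finset ℤ} {y : ℤ} {k : ℕ}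
    (b : Fin k → ℤ) [DecidablePred (· ∈ Set.range b)] : rowRegion Z Dn y b k =
      Z ∪ (fun x => downAt x y) '' ((Dn.filter (· ∉ Set.range b) : Finset ℤ) : Set ℤ) := by
  ext ⟨x, z, u⟩
  have h : ∀ j : Fin k, ¬ k ≤ j.val := fun j => by omega
  simp only [rowRegion, Fin.is_lt, forall_const, h, false_and, exists_false, and_false, or_false,
    Set.mem_ofPred_eq, Set.mem_union, Set.mem_image, Finset.coe_filter, Set.mem_range,
    UnitTriangle.mk.injEq]
  constructor
  · rintro (h | ⟨rfl, rfl, h1, h2⟩)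
    · exact Or.inl h
    · exact Or.inr ⟨x, ⟨h1, fun ⟨j, hj⟩ => h2 j hj.symm⟩, rfl, rfl, rfl⟩
  · rintro (h | ⟨x, ⟨h1, h2⟩, rfl, rfl, rfl⟩)
    · exact Or.inl h
    · exact Or.inr ⟨rfl, rfl, h1, fun j hj => h2 ⟨j, hj.symm⟩⟩

/-- The downward triangles of the row `y` that are not used by a particle combine with the
triangles above them; the particles at positions outside of the region vanish. -/
lemma tilingCount_next_row {n : ℕ} {y : ℤ} (hy : 0 ≤ y) (hy' : y < 4 * n + 2) {k l : ℕ}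
    (b : Fin k → ℤ) (c : Fin l → ℤ)
    (hb : ∀ x ∈ downRow n y, x ∉ Set.range b → upAt x (y + 1) ∈ incompleteHexagon n)
    (hc : ∀ x, (∃ j, x = c j) ↔
      x ∈ downRow n y ∧ (∃ j, x = b j) ∧ upAt x (y + 1) ∈ incompleteHexagon n) :
    tilingCount (rowRegion (hexagonAbove n y) (downRow n y) y b k) =
      tilingCount (rowRegion (hexagonAbove n (y + 1)) (downRow n (y + 1)) (y + 1) c 0) := by
  classical
  rw [rowRegion_last_eq, tilingCount_forced (finite_hexagonAbove n y) lt_of_mem_hexagonAbove]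
  · congr 1
    ext ⟨x, z, u⟩
    rw [mem_rowRegion_zero]
    simp only [hexagonAbove, Set.mem_sdiff, Set.mem_ofPred_eq, Set.mem_image, Finset.coe_filter,
      Set.mem_range, UnitTriangle.mk.injEq, hc, not_exists]
    cases u
    · rw [downAt_mem_incompleteHexagon, mem_downRow]
      simp only [reduceCtorEq, and_false, not_false_eq_true, implies_true, and_true, true_and,
        false_and, or_false]
      omega
    · simp only [reduceCtorEq, false_and, false_or, true_and, and_true]
      constructor
      · rintro ⟨⟨h1, h2⟩, h3⟩
        rcases (show y + 1 < z ∨ z = y + 1 by omega) with h | rfl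
        · exact Or.inl ⟨h1, h⟩
        · have hx : x ∈ downRow n y := by
            rw [upAt_mem_incompleteHexagon] at h1
            rw [mem_downRow]
            omega
          refine Or.inr ⟨rfl, hx, ?_, h1⟩
          by_contra! hne
          exact h3 x ⟨⟨hx, fun j => (hne j).symm⟩, rfl, rfl⟩
      · rintro (⟨h1, h2⟩ | ⟨rfl, hx, ⟨j, hj⟩, h1⟩)
        · exact ⟨⟨h1, by omega⟩, fun a h => by omega⟩
        · refine ⟨⟨h1, by omega⟩, ?_⟩
          rintro a ⟨⟨-, h⟩, rfl, -⟩
          exact absurd hj.symm (h j)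
  · intro x hx
    rw [Finset.mem_filter] at hx
    exact ⟨hb x hx.1 hx.2, by simp⟩

/-! ### Path determinants from the top side down to the bottom side -/

/-- A strictly increasing self-map of a finite chain is the identity. This fixes the configuration
in the top row, where `2 n` particles fill `2 n` sites. -/
lemma strictMono_eq_self {p : ℕ} {b : Fin p → ℤ} (hb : StrictMono b)
    (h : ∀ j, 0 ≤ b j ∧ b j < p) (j : Fin p) : b j = j := by
  let f : Fin p → Fin p := fun j => ⟨(b j).toNat, by have := h j; omega⟩
  have hf : StrictMono f := by
    intro i j hij
    have := hb hij
    have := h i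
    have := h j
    rw [Fin.lt_def]
    simp only [f]
    omega
  have hid : f j = j := le_antisymm hf.apply_le hf.le_apply
  have := congrArg Fin.val hid
  simp only [f] at this
  have := h j
  omega

lemma det_intChoose_zero (p : ℕ) :
    (Matrix.of fun r j : Fin p => intChoose 0 ((j : ℤ) - r)).det = 1 := by
  rw [← Matrix.det_one (n := Fin p) (R := ℚ)]
  congr 1
  ext r j
  rw [Matrix.of_apply, intChoose_zero, Matrix.one_apply]
  congr 1
  rw [eq_iff_iff, Fin.ext_iff]
  omega

/-- The tilings of the upper part of the hexagon, above the two removed triangles. -/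
lemma tilingCount_upper {n d : ℕ} (hd : d ≤ n + 1) (b : Fin (2 * n) → ℤ) (hb : StrictMono b)
    (hmem : ∀ j, b j ∈ downRow n (4 * n + 2 - d)) :
    (tilingCount (rowRegion (hexagonAbove n (4 * n + 2 - d)) (downRow n (4 * n + 2 - d))
      (4 * n + 2 - d) b (2 * n)) : ℚ) =
      (Matrix.of fun r j : Fin (2 * n) => intChoose d (b j - r)).det := by
  induction d generalizing b with
  | zero =>
    have hbj := strictMono_eq_self hb fun j => by
      have := mem_downRow.1 (hmem j)
      push_cast at this ⊢
      omega
    simp only [hbj, det_intChoose_zero]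
    rw [← Nat.cast_one, ← tilingCount_empty]
    congr 2
    rw [Set.eq_empty_iff_forall_notMem]
    rintro ⟨x, y, u⟩ (⟨h1, h2⟩ | ⟨h1, h2, h3, h4⟩ | ⟨h1, h2, j, h3, h4⟩)
    · cases u
      · rw [downAt_mem_incompleteHexagon] at h1
        dsimp only at h2
        push_cast at h2
        omega
      · rw [upAt_mem_incompleteHexagon] at h1
        dsimp only at h2
        push_cast at h2
        omega
    · dsimp only at h1 h2 h3 h4
      rw [mem_downRow] at h3
      push_cast at h3
      refine h4 ⟨x.toNat, by omega⟩ (by omega) ?_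
      rw [hbj]
      dsimp only
      omega
    · omega
  | succ d ih =>
    rw [tilingCount_next_row (by omega) (by push_cast; omega) b b]
    · have hy : (4 * n + 2 - ((d + 1 : ℕ) : ℤ) + 1) = 4 * n + 2 - d := by push_cast; ring
      rw [hy, tilingCount_rowRegion (finite_hexagonAbove _ _) lt_of_mem_hexagonAbove
        (fun r x => intChoose d (x - r)) (ih (by omega)) hb]
      · congr 1
        ext r j
        rw [Matrix.of_apply, Matrix.of_apply, intChoose_succ]
        congr 2
        ring
      -- A site beyond the right boundary is at least `2 n + d`, more than `d` steps from every
      -- target `r < 2 n`; a site beyond the left boundary is negative.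
      · intro j r
        have h := hmem j
        have hr := r.2
        rw [mem_downRow] at h
        push_cast at h
        constructor
        · intro h'
          rw [mem_downRow] at h'
          exact intChoose_of_lt _ (by omega)
        · intro h'
          rw [mem_downRow] at h'
          exact intChoose_of_neg _ (by omega)
    · intro x hx _
      rw [mem_downRow] at hx
      rw [upAt_mem_incompleteHexagon]
      push_cast at hx ⊢
      omega
    · intro x
      rw [upAt_mem_incompleteHexagon]
      constructor
      · rintro ⟨j, rfl⟩
        have h := hmem j
        refine ⟨h, ⟨j, rfl⟩, ?_⟩
        rw [mem_downRow] at h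
        push_cast at h ⊢
        omega
      · exact fun h => h.2.1

/-- The weights of a particle with respect to the two removed triangles in the row `3 n + 1` and
to the upper side of the hexagon, seen from `e` rows below the row `3 n + 1`. -/
def sinkWeight (n e : ℕ) : Fin (2 * n + 2) → ℤ → ℚ :=
  Fin.cons (fun x => intChoose e x) (Fin.snoc (α := fun _ => ℤ → ℚ)
    (fun r : Fin (2 * n) => fun x => intChoose (n + 2 + e) (x - r))
    fun x => intChoose e (x - (3 * n + 1)))

lemma sinkWeight_zero (n e : ℕ) (x : ℤ) : sinkWeight n e 0 x = intChoose e x := rfl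

lemma sinkWeight_last (n e : ℕ) (x : ℤ) :
    sinkWeight n e (Fin.last _).succ x = intChoose e (x - (3 * n + 1)) := by
  rw [sinkWeight, Fin.cons_succ, Fin.snoc_last]

lemma sinkWeight_mid (n e : ℕ) (r : Fin (2 * n)) (x : ℤ) :
    sinkWeight n e r.castSucc.succ x = intChoose (n + 2 + e) (x - r) := by
  rw [sinkWeight, Fin.cons_succ, Fin.snoc_castSucc]

lemma sink_cases {n : ℕ} {P : Fin (2 * n + 2) → Prop} (h0 : P 0) (hl : P (Fin.last _).succ)
    (hm : ∀ r : Fin (2 * n), P r.castSucc.succ) (r : Fin (2 * n + 2)) : P r := by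
  induction r using Fin.cases with
  | zero => exact h0
  | succ r =>
    induction r using Fin.lastCases with
    | last => exact hl
    | cast r => exact hm r

lemma sinkWeight_succ (n e : ℕ) (r : Fin (2 * n + 2)) (x : ℤ) :
    sinkWeight n (e + 1) r x = sinkWeight n e r x + sinkWeight n e r (x - 1) := by
  revert r
  refine sink_cases ?_ ?_ fun r => ?_
  · exact intChoose_succ _ _
  · simp only [sinkWeight_last]
    rw [intChoose_succ]
    congr 2
    ring
  · simp only [sinkWeight_mid]
    rw [← add_assoc, intChoose_succ]
    congr 2
    ring

/-- A determinant with a leading row and a final row that are unit vectors. -/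
lemma det_of_border {R : Type*} [CommRing R] {p : ℕ} (A : Matrix (Fin (p + 2)) (Fin (p + 2)) R)
    (h0 : A 0 0 = 1) (h0' : ∀ j, j ≠ 0 → A 0 j = 0)
    (hl : A (Fin.last _) (Fin.last _) = 1) (hl' : ∀ j, j ≠ Fin.last _ → A (Fin.last _) j = 0) :
    A.det =
      (A.submatrix (fun r : Fin p => r.castSucc.succ) fun r : Fin p => r.castSucc.succ).det := by
  rw [Matrix.det_succ_row A 0, Finset.sum_eq_single 0 (fun j _ hj => by rw [h0' j hj]; ring)
    (by simp), h0, Matrix.det_succ_row _ (Fin.last p), Finset.sum_eq_single (Fin.last p)]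
  · have : (A.submatrix (Fin.succAbove 0) (Fin.succAbove 0)) (Fin.last p) (Fin.last p) = 1 := by
      simpa using hl
    rw [this]
    simp only [Fin.val_zero, Fin.val_last, Even.neg_one_pow (Even.add_self p), add_zero, pow_zero,
      one_mul, Matrix.submatrix_submatrix]
    congr 1
    ext r s
    simp
  · intro j _ hj
    have : (A.submatrix (Fin.succAbove 0) (Fin.succAbove 0)) (Fin.last p) j = 0 := by
      have := hl' j.succ fun h => hj (Fin.succ_injective _ h)
      simpa using this
    rw [this]
    ring
  · simp

/-- The sites `0` and `3 n + 1` are the two ends of row `3 n` and lie under removed triangles, so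
both must be occupied; otherwise the count and a row of the matrix vanish. If both are occupied, the
first and the last particle stop here and the others continue to the top side. -/
lemma tilingCount_sink_row {n : ℕ} (b : Fin (2 * n + 2) → ℤ) (hb : StrictMono b)
    (hmem : ∀ j, b j ∈ downRow n (3 * n)) :
    (tilingCount (rowRegion (hexagonAbove n (3 * n)) (downRow n (3 * n)) (3 * n) b
      (2 * n + 2)) : ℚ) = (Matrix.of fun r j => sinkWeight n 0 r (b j)).det := by
  have hfin := finite_rowRegion (finite_hexagonAbove n (3 * n)) (downRow n (3 * n)) (3 * n) b
    (2 * n + 2)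
  have hmem' : ∀ j, 0 ≤ b j ∧ b j ≤ 3 * n + 1 := fun j => by
    have := mem_downRow.1 (hmem j)
    omega
  -- All upward triangles of this row have been paired and the one above `x` is removed, so a free
  -- downward triangle at `x` has no partner.
  have hno : ∀ x : ℤ, x = 0 ∨ x = 3 * n + 1 → (∀ j, b j ≠ x) →
      tilingCount (rowRegion (hexagonAbove n (3 * n)) (downRow n (3 * n)) (3 * n) b
        (2 * n + 2)) = 0 := by
    intro x hx hj
    refine tilingCount_eq_zero hfin (x := x) (y := 3 * n) ?_ ?_ ?_ ?_
    · refine Or.inr (Or.inl ⟨rfl, rfl, ?_, fun j _ => (hj j).symm⟩)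
      rw [mem_downRow]
      dsimp only
      omega
    · rintro (h | h | ⟨-, -, j, h, -⟩)
      · exact lt_irrefl _ h.2
      · exact absurd h.1 (by simp)
      · omega
    · rintro (h | h | ⟨-, -, j, h, -⟩)
      · exact lt_irrefl _ h.2
      · exact absurd h.1 (by simp)
      · omega
    · rintro (⟨h, -⟩ | h | ⟨-, -, j, h, -⟩)
      · rw [upAt_mem_incompleteHexagon] at h
        omega
      · exact absurd h.1 (by simp)
      · omega
  by_cases h0 : ∀ j, b j ≠ 0
  · rw [hno 0 (Or.inl rfl) h0, Nat.cast_zero, eq_comm]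
    refine Matrix.det_eq_zero_of_row_eq_zero 0 fun j => ?_
    rw [Matrix.of_apply, sinkWeight_zero, intChoose_zero, if_neg (h0 j)]
  by_cases hl : ∀ j, b j ≠ 3 * n + 1
  · rw [hno _ (Or.inr rfl) hl, Nat.cast_zero, eq_comm]
    refine Matrix.det_eq_zero_of_row_eq_zero (Fin.last _).succ fun j => ?_
    rw [Matrix.of_apply, sinkWeight_last, intChoose_zero, if_neg]
    have := hl j
    omega
  push Not at h0 hl
  obtain ⟨j0, h0⟩ := h0
  obtain ⟨jl, hl⟩ := hl
  have hb0 : b 0 = 0 := by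
    have := hb.monotone (Fin.zero_le j0)
    have := (hmem' 0).1
    omega
  have hbl : b (Fin.last _) = 3 * n + 1 := by
    have := hb.monotone (Fin.le_last jl)
    have := (hmem' (Fin.last _)).2
    omega
  let c : Fin (2 * n) → ℤ := fun j => b j.castSucc.succ
  have hc : StrictMono c := fun i j hij => hb (by simpa using hij)
  have hcb : ∀ j, 0 < c j ∧ c j < 3 * n + 1 := by
    intro j
    constructor
    · rw [← hb0]
      exact hb (Fin.succ_pos _)
    · rw [← hbl]
      exact hb (by rw [Fin.lt_def]; simp)
  rw [tilingCount_next_row (by omega) (by omega) b c]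
  · have hd : (4 * n + 2 - ((n + 1 : ℕ) : ℤ)) = 3 * n + 1 := by push_cast; ring
    have hup := fun b hb hm => tilingCount_upper (n := n) (le_refl (n + 1)) b hb hm
    rw [hd] at hup
    rw [tilingCount_rowRegion (finite_hexagonAbove _ _) lt_of_mem_hexagonAbove
        (fun r x => intChoose (n + 1) (x - r)) hup hc]
    · rw [det_of_border]
      · congr 1
        ext r j
        simp only [Matrix.submatrix_apply, Matrix.of_apply, sinkWeight_mid]
        rw [show n + 2 + 0 = n + 1 + 1 by omega, intChoose_succ (n + 1) (b j.castSucc.succ - r)]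
        simp only [c, sub_right_comm]
      · rw [Matrix.of_apply, sinkWeight_zero, hb0, intChoose_zero, if_pos rfl]
      · intro j hj
        rw [Matrix.of_apply, sinkWeight_zero, intChoose_zero, if_neg]
        rw [← hb0]
        exact hb.injective.ne hj
      · rw [Matrix.of_apply, ← Fin.succ_last, sinkWeight_last, Fin.succ_last, hbl, intChoose_zero,
          if_pos (sub_self _)]
      · intro j hj
        rw [Matrix.of_apply, ← Fin.succ_last, sinkWeight_last, intChoose_zero, if_neg]
        rw [← hbl, sub_eq_zero]
        exact hb.injective.ne hj
    · intro j r
      have h := hcb j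
      have hr := r.2
      constructor
      · intro h'
        rw [mem_downRow] at h'
        exact intChoose_of_lt _ (by push_cast; omega)
      · intro h'
        rw [mem_downRow] at h'
        exact intChoose_of_neg _ (by omega)
  · intro x hx hxb
    have h1 : x ≠ 0 := fun h => hxb ⟨0, by rw [hb0, h]⟩
    have h2 : x ≠ 3 * n + 1 := fun h => hxb ⟨Fin.last _, by rw [hbl, h]⟩
    rw [mem_downRow] at hx
    rw [upAt_mem_incompleteHexagon]
    omega
  · intro x
    rw [upAt_mem_incompleteHexagon]
    constructor
    · rintro ⟨j, rfl⟩
      have h := hcb j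
      exact ⟨hmem _, ⟨_, rfl⟩, by omega⟩
    · rintro ⟨hx, ⟨j, rfl⟩, h⟩
      have hj0 : j ≠ 0 := fun hj => by rw [hj, hb0] at h; omega
      have hjl : j ≠ Fin.last _ := fun hj => by rw [hj, hbl] at h; omega
      revert hj0 hjl
      refine sink_cases (P := fun j => j ≠ 0 → j ≠ Fin.last _ → ∃ i, b j = c i) ?_ ?_ ?_ j
      · exact fun h => absurd rfl h
      · exact fun _ h => absurd (Fin.succ_last _) h
      · exact fun r _ _ => ⟨r, rfl⟩

/-- The hypotheses leave only the site with `x + y = 6 n + 2` in the row `y = 3 n - e`, one step too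
far right to reach any sink. -/
lemma sinkWeight_vanish {n e : ℕ} {x : ℤ} (h1 : x ∉ downRow n (3 * n - e)) (hx0 : 0 ≤ x)
    (hx1 : x ≤ 4 * n + 2) (hx : 2 * n ≤ x + (3 * n - e)) (hx' : x + (3 * n - e) ≤ 6 * n + 2)
    (r : Fin (2 * n + 2)) : sinkWeight n e r x = 0 := by
  rw [mem_downRow] at h1
  revert r
  refine sink_cases ?_ ?_ fun r => ?_
  · rw [sinkWeight_zero]
    exact intChoose_of_lt _ (by omega)
  · rw [sinkWeight_last]
    exact intChoose_of_lt _ (by omega)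
  · rw [sinkWeight_mid]
    have := r.2
    exact intChoose_of_lt _ (by push_cast; omega)

lemma sinkWeight_of_neg {n e : ℕ} {x : ℤ} (h1 : x < 0) (r : Fin (2 * n + 2)) :
    sinkWeight n e r x = 0 := by
  revert r
  refine sink_cases ?_ ?_ fun r => ?_
  · rw [sinkWeight_zero]
    exact intChoose_of_neg _ (by omega)
  · rw [sinkWeight_last]
    exact intChoose_of_neg _ (by omega)
  · rw [sinkWeight_mid]
    exact intChoose_of_neg _ (by omega)

lemma tilingCount_row_of_down {n e : ℕ}
    (h : ∀ b : Fin (2 * n + 2) → ℤ, StrictMono b → (∀ j, b j ∈ downRow n (3 * n - e)) →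
      (tilingCount (rowRegion (hexagonAbove n (3 * n - e)) (downRow n (3 * n - e)) (3 * n - e) b
        (2 * n + 2)) : ℚ) = (Matrix.of fun r j => sinkWeight n e r (b j)).det)
    {c : Fin (2 * n + 2) → ℤ} (hc : StrictMono c)
    (hmem : ∀ j, 0 ≤ c j ∧ c j ≤ 4 * n + 2 ∧ 2 * n ≤ c j + (3 * n - e) ∧
      c j + (3 * n - e) ≤ 6 * n + 2) :
    (tilingCount (rowRegion (hexagonAbove n (3 * n - e)) (downRow n (3 * n - e)) (3 * n - e) c
      0) : ℚ) = (Matrix.of fun r j => sinkWeight n (e + 1) r (c j)).det := by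
  rw [tilingCount_rowRegion (finite_hexagonAbove _ _) lt_of_mem_hexagonAbove _ h hc]
  · simp only [← sinkWeight_succ]
  · intro j r
    obtain ⟨h1, h2, h3, h4⟩ := hmem j
    refine ⟨fun h => sinkWeight_vanish h h1 h2 h3 h4 r, fun h => sinkWeight_of_neg ?_ r⟩
    rw [mem_downRow] at h
    omega

/-- Below row `3 n` no particle is absorbed, since every downward triangle has an upward triangle of
the region above it; each row just applies Pascal's rule to the weights. -/
lemma tilingCount_lower {n e : ℕ} (he : e ≤ 3 * n) (b : Fin (2 * n + 2) → ℤ) (hb : StrictMono b)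
    (hmem : ∀ j, b j ∈ downRow n (3 * n - e)) :
    (tilingCount (rowRegion (hexagonAbove n (3 * n - e)) (downRow n (3 * n - e)) (3 * n - e) b
      (2 * n + 2)) : ℚ) = (Matrix.of fun r j => sinkWeight n e r (b j)).det := by
  induction e generalizing b with
  | zero =>
    have := tilingCount_sink_row (n := n) b hb
    simp only [Nat.cast_zero, sub_zero] at hmem ⊢
    exact this hmem
  | succ e ih =>
    have hy : (3 * n - ((e + 1 : ℕ) : ℤ) + 1) = 3 * n - e := by push_cast; ring
    have hmem' := fun j => mem_downRow.1 (hmem j)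
    push_cast at hmem'
    rw [tilingCount_next_row (by omega) (by push_cast; omega) b b, hy,
      tilingCount_row_of_down (ih (by omega)) hb]
    · intro j
      have := hmem' j
      omega
    · intro x hx _
      rw [mem_downRow] at hx
      rw [upAt_mem_incompleteHexagon]
      push_cast at hx ⊢
      omega
    · intro x
      rw [upAt_mem_incompleteHexagon]
      constructor
      · rintro ⟨j, rfl⟩
        have h := hmem' j
        refine ⟨hmem j, ⟨j, rfl⟩, ?_⟩
        push_cast
        omega
      · exact fun h => h.2.1

/-- The positions on the lower side of the hexagon except for the middle one. -/
def bottomPosition (n : ℕ) (j : Fin (2 * n + 2)) : ℕ :=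
  if j.val < n + 1 then 2 * n + j else 2 * n + j + 1

/-- The tilings of the incomplete hexagon are counted by a determinant of binomial
coefficients. -/
theorem tilingCount_incompleteHexagon (n : ℕ) :
    (tilingCount (incompleteHexagon n) : ℚ) =
      (Matrix.of fun r j => sinkWeight n (3 * n + 1) r (bottomPosition n j)).det := by
  have hy : (3 * n - ((3 * n : ℕ) : ℤ)) = 0 := by push_cast; ring
  -- Row `0` is written as `3 n - e` with `e = 3 n` to match the recursion; the step inside row `0`
  -- itself raises the index to `3 n + 1`.
  have hreg : incompleteHexagon n = rowRegion (hexagonAbove n (3 * n - (3 * n : ℕ)))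
      (downRow n (3 * n - (3 * n : ℕ))) (3 * n - (3 * n : ℕ))
      (fun j => (bottomPosition n j : ℤ)) 0 := by
    rw [hy]
    ext ⟨x, y, u⟩
    rw [mem_rowRegion_zero]
    simp only [hexagonAbove, Set.mem_ofPred_eq]
    cases u
    · simp only [downAt_mem_incompleteHexagon, mem_downRow, true_and, reduceCtorEq, false_and,
        or_false]
      omega
    · simp only [upAt_mem_incompleteHexagon, true_and, reduceCtorEq, false_and, false_or]
      constructor
      · intro h
        rcases (show 0 < y ∨ y = 0 by omega) with hy | rfl
        · exact Or.inl ⟨h, hy⟩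
        · refine Or.inr ⟨rfl, ?_⟩
          by_cases hx : x < 3 * n + 1
          · refine ⟨⟨(x - 2 * n).toNat, by omega⟩, ?_⟩
            rw [bottomPosition, if_pos (by dsimp only; omega)]
            push_cast
            omega
          · refine ⟨⟨(x - 2 * n - 1).toNat, by omega⟩, ?_⟩
            rw [bottomPosition, if_neg (by dsimp only; omega)]
            push_cast
            omega
      · rintro (h | ⟨rfl, j, rfl⟩)
        · exact h.1
        · have := j.2
          rw [bottomPosition]
          split_ifs <;> push_cast <;> simp only [true_and, and_true] <;> omega
  conv_lhs => rw [hreg]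
  rw [tilingCount_row_of_down (tilingCount_lower le_rfl)]
  · intro i j hij
    rw [Fin.lt_def] at hij
    simp only [bottomPosition]
    split_ifs <;> push_cast <;> omega
  · intro j
    have := j.2
    simp only [bottomPosition]
    split_ifs <;> push_cast <;> omega

/-! ### Finite differences and Newton expansion -/

section DeterminantEvaluation

open scoped fwdDiff

lemma fwdDiff_iter_eq_sum (f : ℕ → ℚ) (x y : ℕ) : Δ_[1] ^[x] f y =
    ∑ s ∈ Finset.range (x + 1), (-1) ^ (x - s) * (x.choose s : ℚ) * f (y + s) := by
  rw [fwdDiff_iter_eq_sum_shift]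
  refine Finset.sum_congr rfl fun s _ => ?_
  rw [zsmul_eq_mul, nsmul_one]
  push_cast
  rfl

/-- By Pascal's rule, a difference in the upper index lowers the lower index by one. -/
lemma fwdDiff_iter_intChoose (x : ℕ) (a : ℤ) : Δ_[1] ^[x] (fun y : ℕ => intChoose y a) =
    fun y : ℕ => intChoose y (a - x) := by
  induction x with
  | zero => simp
  | succ x ih =>
    rw [Function.iterate_succ_apply', ih]
    funext y
    rw [fwdDiff, intChoose_succ]
    push_cast
    rw [sub_sub]
    ring

lemma fwdDiff_iter_choose_apply (x a y : ℕ) :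
    Δ_[1] ^[x] (fun y : ℕ => (y.choose a : ℚ)) y = intChoose y (a - x) := by
  simp only [← intChoose_natCast]
  rw [fwdDiff_iter_intChoose]

lemma fwdDiff_iter_eval_natCast (P : Polynomial ℚ) (x y : ℕ) :
    Δ_[1] ^[x] (fun y : ℕ => P.eval (y : ℚ)) y = Δ_[1] ^[x] (fun y : ℚ => P.eval y) (y : ℚ) := by
  rw [fwdDiff_iter_eq_sum_shift, fwdDiff_iter_eq_sum_shift]
  refine Finset.sum_congr rfl fun s _ => ?_
  simp

/-- The Newton expansion of a polynomial that vanishes at `0, …, d - 1`. -/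
lemma eval_eq_sum_choose {P : Polynomial ℚ} {d q : ℕ} (hP : P.natDegree < d + q)
    (h0 : ∀ a < d, P.eval (a : ℚ) = 0) : (fun y : ℕ => P.eval (y : ℚ)) =
      ∑ i ∈ Finset.range q, Δ_[1] ^[d + i] (fun y : ℕ => P.eval (y : ℚ)) 0 •
        fun y : ℕ => (y.choose (d + i) : ℚ) := by
  funext y
  set f : ℕ → ℚ := fun y => P.eval (y : ℚ) with hf
  have h1 : f y = ∑ a ∈ Finset.range (y + 1), (y.choose a : ℚ) * Δ_[1] ^[a] f 0 := by
    have := shift_eq_sum_fwdDiff_iter 1 f y 0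
    simpa using this
  have hlow : ∀ a < d, Δ_[1] ^[a] f 0 = 0 := by
    intro a ha
    rw [fwdDiff_iter_eq_sum]
    refine Finset.sum_eq_zero fun s hs => ?_
    rw [Finset.mem_range] at hs
    have h : f s = 0 := h0 s (by omega)
    rw [zero_add, h, mul_zero]
  -- Together with `hlow` this confines the Newton series to `d ≤ a < d + q`: the degree kills the
  -- high differences, the prescribed zeros the low ones.
  have hhigh : ∀ a, d + q ≤ a → Δ_[1] ^[a] f 0 = 0 := by
    intro a ha
    rw [hf, fwdDiff_iter_eval_natCast,
      Polynomial.fwdDiff_iter_eq_zero_of_degree_lt (lt_of_lt_of_le hP ha)]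
    rfl
  have h2 : ∑ a ∈ Finset.range (y + 1), (y.choose a : ℚ) * Δ_[1] ^[a] f 0 =
      ∑ a ∈ Finset.range (y + 1 + (d + q)), (y.choose a : ℚ) * Δ_[1] ^[a] f 0 := by
    refine Finset.sum_subset (Finset.range_mono (by omega)) fun a _ ha => ?_
    rw [Finset.mem_range] at ha
    rw [Nat.choose_eq_zero_of_lt (by omega), Nat.cast_zero, zero_mul]
  have h3 : ∑ a ∈ Finset.range (d + q), (y.choose a : ℚ) * Δ_[1] ^[a] f 0 =
      ∑ a ∈ Finset.range (y + 1 + (d + q)), (y.choose a : ℚ) * Δ_[1] ^[a] f 0 := by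
    refine Finset.sum_subset (Finset.range_mono (by omega)) fun a _ ha => ?_
    rw [Finset.mem_range] at ha
    rw [hhigh a (by omega), mul_zero]
  change f y = _
  rw [h1, h2, ← h3, Finset.sum_range_add, Finset.sum_eq_zero, zero_add, Finset.sum_apply]
  · refine Finset.sum_congr rfl fun i _ => ?_
    rw [Pi.smul_apply, smul_eq_mul, mul_comm]
  · intro a ha
    rw [hlow a (Finset.mem_range.1 ha), mul_zero]

/-- The substitution reverses the order of the `k` factors and changes the sign of each. -/
lemma descPochhammer_eval_reflect (k : ℕ) (z : ℚ) :
    (descPochhammer ℚ k).eval ((k : ℚ) - 1 - z) = (-1) ^ k * (descPochhammer ℚ k).eval z := by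
  rw [descPochhammer_eval_eq_prod_range, descPochhammer_eval_eq_prod_range,
    ← Finset.prod_range_reflect, ← Finset.card_range k, ← Finset.prod_const, Finset.card_range,
    ← Finset.prod_mul_distrib]
  refine Finset.prod_congr rfl fun j hj => ?_
  rw [Finset.mem_range] at hj
  rw [Nat.sub_sub, Nat.cast_sub (by omega)]
  push_cast
  ring

/-! ### Alternating binomial sums -/

section AlternatingSums

lemma sum_neg_one_choose_mul_choose (N a b : ℕ) :
    ∑ i ∈ Finset.range (N + 1), (-1 : ℚ) ^ i * N.choose i * (a + i).choose b =
      (-1) ^ N * intChoose a (b - N) := by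
  rw [← fwdDiff_iter_choose_apply, fwdDiff_iter_eq_sum, Finset.mul_sum]
  refine Finset.sum_congr rfl fun i hi => ?_
  rw [Finset.mem_range] at hi
  obtain ⟨l, rfl⟩ : ∃ l, N = i + l := ⟨N - i, by omega⟩
  rw [Nat.add_sub_cancel_left, pow_add]
  have : ((-1 : ℚ) ^ l) * (-1) ^ l = 1 := by rw [← mul_pow]; simp
  linear_combination (-(-1 : ℚ) ^ i * ((i + l).choose i) * ((a + i).choose b)) * this

/-- Absorption, `i * (N + 1).choose i = (N + 1) * N.choose (i - 1)`: a factor `i` is traded for a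
difference of lower order. -/
lemma sum_neg_one_choose_mul_self (N : ℕ) (g : ℕ → ℚ) :
    ∑ i ∈ Finset.range (N + 2), (-1 : ℚ) ^ i * (N + 1).choose i * (i * g i) =
      -(N + 1) * ∑ i ∈ Finset.range (N + 1), (-1 : ℚ) ^ i * N.choose i * g (i + 1) := by
  rw [Finset.sum_range_succ', Finset.mul_sum]
  simp only [Nat.cast_zero, zero_mul, mul_zero, add_zero]
  refine Finset.sum_congr rfl fun i _ => ?_
  have h : ((N + 1 : ℕ) : ℚ) * N.choose i = (N + 1).choose (i + 1) * (i + 1 : ℕ) := by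
    exact_mod_cast Nat.add_one_mul_choose_eq N i
  push_cast at h ⊢
  rw [pow_succ]
  linear_combination ((-1 : ℚ) ^ i * g (i + 1)) * h

lemma sum_linear (n : ℕ) :
    ∑ i ∈ Finset.range (n + 2), (-1 : ℚ) ^ i * (n + 1).choose i *
      (i * (3 * n + 1 + i).choose (2 * n)) =
      -(-1) ^ n * (n + 1) * (3 * n + 2).choose n := by
  rw [sum_neg_one_choose_mul_self n fun i => ((3 * n + 1 + i).choose (2 * n) : ℚ)]
  have := sum_neg_one_choose_mul_choose n (3 * n + 2) (2 * n)
  rw [show (((2 * n : ℕ) : ℤ) - n) = (n : ℕ) by push_cast; ring, intChoose_natCast] at this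
  rw [Finset.sum_congr rfl fun i _ => by rw [show 3 * n + 1 + (i + 1) = 3 * n + 2 + i by ring],
    this]
  ring

lemma sum_quadratic (n : ℕ) :
    ∑ i ∈ Finset.range (n + 2), (-1 : ℚ) ^ i * (n + 1).choose i *
      (i ^ 2 * (3 * n + 1 + i).choose (2 * n)) =
      -(-1) ^ n * (n + 1) * (3 * n + 2).choose n * (3 * n + 1) := by
  have h1 : ∀ i : ℕ, (i ^ 2 * (3 * n + 1 + i).choose (2 * n) : ℚ) =
      i * (i * (3 * n + 1 + i).choose (2 * n)) := fun i => by ring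
  simp only [h1]
  rw [sum_neg_one_choose_mul_self n fun i => (i * (3 * n + 1 + i).choose (2 * n) : ℚ)]
  have h2 : ∀ i : ℕ, (-1 : ℚ) ^ i * n.choose i *
      ((i + 1 : ℕ) * (3 * n + 1 + (i + 1)).choose (2 * n)) =
      (-1 : ℚ) ^ i * n.choose i * (3 * n + 2 + i).choose (2 * n) +
      (-1 : ℚ) ^ i * n.choose i * (i * (3 * n + 2 + i).choose (2 * n)) := fun i => by
    rw [show 3 * n + 1 + (i + 1) = 3 * n + 2 + i by ring]
    push_cast
    ring
  have h3 := sum_neg_one_choose_mul_choose n (3 * n + 2) (2 * n)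
  rw [show (((2 * n : ℕ) : ℤ) - n) = (n : ℕ) by push_cast; ring, intChoose_natCast] at h3
  simp only [h2]
  rw [Finset.sum_add_distrib, h3]
  have h4 : ∑ i ∈ Finset.range (n + 1), (-1 : ℚ) ^ i * n.choose i *
      (i * (3 * n + 2 + i).choose (2 * n)) = (-1) ^ n * (3 * n * (3 * n + 2).choose n) := by
    rcases n with _ | k
    · simp
    · rw [sum_neg_one_choose_mul_self k
        fun i => ((3 * (k + 1) + 2 + i).choose (2 * (k + 1)) : ℚ)]
      have h5 := sum_neg_one_choose_mul_choose k (3 * (k + 1) + 3) (2 * (k + 1))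
      rw [show (((2 * (k + 1) : ℕ) : ℤ) - k) = (k + 2 : ℕ) by push_cast; ring,
        intChoose_natCast] at h5
      rw [Finset.sum_congr rfl fun i _ => by
        rw [show 3 * (k + 1) + 2 + (i + 1) = 3 * (k + 1) + 3 + i by ring], h5]
      -- With `n = k + 1` this says `(3 n + 3).choose (n + 1) = 3 * (3 n + 2).choose n`, which
      -- brings both parts of the sum to the same binomial coefficient.
      have h6 : ((3 * (k + 1) + 2 + 1 : ℕ) : ℚ) * (3 * (k + 1) + 2).choose (k + 1) =
          (3 * (k + 1) + 2 + 1).choose (k + 1 + 1) * (k + 1 + 1 : ℕ) := by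
        exact_mod_cast Nat.add_one_mul_choose_eq (3 * (k + 1) + 2) (k + 1)
      have h7 : ((k : ℚ) + 2) * ((3 * (k + 1) + 3).choose (k + 2) : ℕ) =
          (k + 2) * (3 * (3 * (k + 1) + 2).choose (k + 1)) := by
        push_cast at h6
        linear_combination -h6
      have h8 := mul_left_cancel₀ (by positivity : (k : ℚ) + 2 ≠ 0) h7
      rw [h8, pow_succ]
      push_cast
      ring
  rw [h4]
  ring

end AlternatingSums

open Polynomial

/-! ### The adapted basis and its central sums -/

/-- A basis of the polynomials that vanish at `0, …, 2 n - 1`, adapted to the zeros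
`4 n + 3, …, 6 n + 2`. -/
noncomputable def adaptedPoly (n j : ℕ) : ℚ[X] :=
  descPochhammer ℚ (2 * n) *
    ((descPochhammer ℚ (min j (2 * n))).comp (X - C ((4 * n + 3 : ℕ) : ℚ)) *
      (X - C ((3 * n + 1 : ℕ) : ℚ)) ^ (j - 2 * n))

lemma monic_adaptedPoly (n j : ℕ) : (adaptedPoly n j).Monic :=
  (monic_descPochhammer ℚ _).mul
    (((monic_descPochhammer ℚ _).comp_X_sub_C _).mul ((monic_X_sub_C _).pow _))

lemma natDegree_adaptedPoly (n j : ℕ) : (adaptedPoly n j).natDegree = 2 * n + j := by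
  rw [adaptedPoly, (monic_descPochhammer ℚ _).natDegree_mul
    (((monic_descPochhammer ℚ _).comp_X_sub_C _).mul ((monic_X_sub_C _).pow _)),
    ((monic_descPochhammer ℚ _).comp_X_sub_C _).natDegree_mul ((monic_X_sub_C _).pow _),
    natDegree_comp, descPochhammer_natDegree, descPochhammer_natDegree, natDegree_X_sub_C,
    natDegree_pow, natDegree_X_sub_C]
  omega

lemma adaptedPoly_eval (n j : ℕ) (y : ℚ) : (adaptedPoly n j).eval y =
    (descPochhammer ℚ (2 * n)).eval y *
      ((descPochhammer ℚ (min j (2 * n))).eval (y - (4 * n + 3 : ℕ)) *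
        (y - (3 * n + 1 : ℕ)) ^ (j - 2 * n)) := by
  simp [adaptedPoly]

lemma adaptedPoly_eval_eq_zero (n j : ℕ) {a : ℕ} (ha : a < 2 * n) :
    (adaptedPoly n j).eval (a : ℚ) = 0 := by
  rw [adaptedPoly_eval, descPochhammer_eval_eq_descFactorial,
    Nat.descFactorial_eq_zero_iff_lt.2 ha, Nat.cast_zero, zero_mul]

lemma adaptedPoly_eval_add (n j s : ℕ) : (adaptedPoly n j).eval ((4 * n + 3 + s : ℕ) : ℚ) =
    (4 * n + 3 + s).descFactorial (2 * n) * (s.descFactorial (min j (2 * n)) *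
        (((4 * n + 3 + s : ℕ) : ℚ) - (3 * n + 1 : ℕ)) ^ (j - 2 * n)) := by
  rw [adaptedPoly_eval, descPochhammer_eval_eq_descFactorial,
    show ((4 * n + 3 + s : ℕ) : ℚ) - (4 * n + 3 : ℕ) = s by push_cast; ring,
    descPochhammer_eval_eq_descFactorial]

/-- From index `2 n` on, both groups of zeros are complete and are exchanged by `y ↦ 6 n + 2 - y`;
the reflection sign is `(-1) ^ (2 n) = 1`. -/
lemma adaptedPoly_eval_special (n k : ℕ) {y y' : ℕ} (hy : y + y' = 6 * n + 2) :
    (adaptedPoly n (2 * n + k)).eval (y : ℚ) =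
      y.descFactorial (2 * n) * y'.descFactorial (2 * n) * ((y : ℚ) - (3 * n + 1 : ℕ)) ^ k := by
  have h : (y : ℚ) - (4 * n + 3 : ℕ) = ((2 * n : ℕ) : ℚ) - 1 - y' := by
    have : (y : ℚ) + y' = 6 * n + 2 := by exact_mod_cast hy
    push_cast
    linear_combination this
  rw [adaptedPoly_eval, min_eq_right (by omega), Nat.add_sub_cancel_left, h,
    descPochhammer_eval_reflect, descPochhammer_eval_eq_descFactorial,
    descPochhammer_eval_eq_descFactorial, pow_mul]
  ring

/-- Both sides count the disjoint choices of an `i`-set and an ordered `2 n`-tuple of distinct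
elements from `3 n + 1` elements. This cuts the central sum down to a difference of order `n + 1`.
-/
lemma choose_mul_descFactorial (n i : ℕ) :
    (3 * n + 1).choose i * (3 * n + 1 - i).descFactorial (2 * n) =
      (3 * n + 1).descFactorial (2 * n) * (n + 1).choose i := by
  rcases le_or_gt i (n + 1) with hi | hi
  · rw [Nat.descFactorial_eq_factorial_mul_choose, Nat.descFactorial_eq_factorial_mul_choose]
    have h := Nat.choose_mul (n := 3 * n + 1) (k := i + 2 * n) (s := i) (by omega)
    have h' := Nat.choose_mul (n := 3 * n + 1) (k := i + 2 * n) (s := 2 * n) (by omega)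
    have hsymm : (i + 2 * n).choose i = (i + 2 * n).choose (2 * n) :=
      Nat.choose_symm_of_eq_add rfl
    rw [show i + 2 * n - i = 2 * n by omega] at h
    rw [show i + 2 * n - 2 * n = i by omega, show 3 * n + 1 - 2 * n = n + 1 by omega,
      ← hsymm, h] at h'
    linear_combination (2 * n).factorial * h'
  · rw [Nat.choose_eq_zero_of_lt hi, mul_zero, mul_eq_zero]
    rcases le_or_gt i (3 * n + 1) with hi' | hi'
    · exact Or.inr (Nat.descFactorial_eq_zero_iff_lt.2 (by omega))
    · exact Or.inl (Nat.choose_eq_zero_of_lt hi')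

/-- The alternating sum of the values of the adapted polynomials at one side of the centre. -/
def centralSum (n k : ℕ) : ℚ :=
  ∑ i ∈ Finset.range (3 * n + 2), (-1 : ℚ) ^ i * (3 * n + 1).choose i *
    ((3 * n + 1 + i).descFactorial (2 * n) * (3 * n + 1 - i).descFactorial (2 * n) * i ^ k)

lemma centralSum_eq (n k : ℕ) : centralSum n k =
    (2 * n).factorial * (3 * n + 1).descFactorial (2 * n) *
      ∑ i ∈ Finset.range (n + 2), (-1 : ℚ) ^ i * (n + 1).choose i *
        (i ^ k * (3 * n + 1 + i).choose (2 * n)) := by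
  have h : centralSum n k = ∑ i ∈ Finset.range (3 * n + 2),
      (2 * n).factorial * (3 * n + 1).descFactorial (2 * n) * ((-1 : ℚ) ^ i * (n + 1).choose i *
        (i ^ k * (3 * n + 1 + i).choose (2 * n))) := by
    refine Finset.sum_congr rfl fun i _ => ?_
    have h1 : ((3 * n + 1).choose i : ℚ) * (3 * n + 1 - i).descFactorial (2 * n) =
        (3 * n + 1).descFactorial (2 * n) * (n + 1).choose i := by
      exact_mod_cast choose_mul_descFactorial n i
    rw [Nat.descFactorial_eq_factorial_mul_choose (3 * n + 1 + i)]
    push_cast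
    linear_combination
      ((-1 : ℚ) ^ i * (2 * n).factorial * (3 * n + 1 + i).choose (2 * n) * i ^ k) * h1
  rw [h, ← Finset.mul_sum]
  congr 1
  symm
  refine Finset.sum_subset (Finset.range_mono (by omega)) fun i _ hi => ?_
  rw [Finset.mem_range] at hi
  rw [Nat.choose_eq_zero_of_lt (by omega : n + 1 < i)]
  simp

/-- This proportionality makes the final `3 × 3` determinant a multiple of `centralSum n 1 ^ 2`. -/
lemma centralSum_two (n : ℕ) : centralSum n 2 = (3 * n + 1) * centralSum n 1 := by
  have h := sum_linear n
  simp only [centralSum_eq, sum_quadratic, pow_one, h]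
  ring

lemma centralSum_one_sq (n : ℕ) : centralSum n 1 ^ 2 =
    ((2 * n).factorial * (3 * n + 1).descFactorial (2 * n) * (n + 1) *
      (3 * n + 2).choose n) ^ 2 := by
  have h := sum_linear n
  have h1 : ((-1 : ℚ) ^ n) ^ 2 = 1 := by rw [← pow_mul, mul_comm, pow_mul]; simp
  simp only [centralSum_eq, pow_one, h]
  linear_combination (((2 * n).factorial * (3 * n + 1).descFactorial (2 * n) * (n + 1) *
      (3 * n + 2).choose n : ℚ) ^ 2) * h1

lemma fwdDiff_adaptedPoly_right (n k : ℕ) :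
    Δ_[1] ^[3 * n + 1] (fun y : ℕ => (adaptedPoly n (2 * n + k)).eval (y : ℚ)) (3 * n + 1) =
      (-1) ^ (3 * n + 1) * centralSum n k := by
  rw [fwdDiff_iter_eq_sum, centralSum, Finset.mul_sum]
  refine Finset.sum_congr rfl fun i hi => ?_
  rw [Finset.mem_range] at hi
  rw [adaptedPoly_eval_special n k (y' := 3 * n + 1 - i) (by omega)]
  obtain ⟨l, hl⟩ : ∃ l, 3 * n + 1 = i + l := ⟨3 * n + 1 - i, by omega⟩
  have h1 : (-1 : ℚ) ^ (3 * n + 1) * (-1) ^ i = (-1) ^ (3 * n + 1 - i) := by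
    rw [hl, Nat.add_sub_cancel_left, pow_add]
    have : ((-1 : ℚ) ^ i) * (-1) ^ i = 1 := by rw [← mul_pow]; simp
    linear_combination (-1 : ℚ) ^ l * this
  rw [← h1]
  push_cast
  ring

/-- Reversing the sum reflects the sample points about `3 n + 1`; the symmetric factor is unchanged
and the power contributes the sign `(-1) ^ k`. -/
lemma fwdDiff_adaptedPoly_bottom (n k : ℕ) :
    Δ_[1] ^[3 * n + 1] (fun y : ℕ => (adaptedPoly n (2 * n + k)).eval (y : ℚ)) 0 =
      (-1) ^ k * centralSum n k := by
  rw [fwdDiff_iter_eq_sum, centralSum, Finset.mul_sum, ← Finset.sum_range_reflect]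
  refine Finset.sum_congr rfl fun i hi => ?_
  rw [Finset.mem_range] at hi
  rw [show 3 * n + 1 + 1 - 1 - i = 3 * n + 1 - i by omega, zero_add,
    adaptedPoly_eval_special n k (y' := 3 * n + 1 + i) (by omega), Nat.choose_symm (by omega),
    Nat.sub_sub_self (by omega), Nat.cast_sub (by omega), sub_sub_cancel_left, neg_pow]
  ring

/-! ### Factorization of the determinant -/

/-- The points `(x, y)` of the functionals `f ↦ Δ^x f (y)` that belong to the upper side and to
the three removed triangles. -/
def sinkPoint (n : ℕ) : Fin (2 * n) ⊕ Fin 3 → ℕ × ℕ :=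
  Sum.elim (fun r => (r, 4 * n + 3))
    ![(3 * n + 1, 0), (0, 3 * n + 1), (3 * n + 1, 3 * n + 1)]

/-- The values of the functionals at the adapted polynomials. -/
noncomputable def adaptedMatrix (n : ℕ) : Matrix (Fin (2 * n) ⊕ Fin 3) (Fin (2 * n + 3)) ℚ :=
  Matrix.of fun s j =>
    Δ_[1] ^[(sinkPoint n s).1] (fun y : ℕ => (adaptedPoly n j).eval (y : ℚ)) (sinkPoint n s).2

/-- The values of the functionals at the binomial coefficients. -/
def binomialMatrix (n : ℕ) : Matrix (Fin (2 * n) ⊕ Fin 3) (Fin (2 * n + 3)) ℚ :=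
  Matrix.of fun s j => intChoose (sinkPoint n s).2 ((2 * n + j : ℕ) - (sinkPoint n s).1)

/-- The Newton coefficients of the adapted polynomials. -/
noncomputable def newtonMatrix (n : ℕ) : Matrix (Fin (2 * n + 3)) (Fin (2 * n + 3)) ℚ :=
  Matrix.of fun i j => Δ_[1] ^[2 * n + i] (fun y : ℕ => (adaptedPoly n j).eval (y : ℚ)) 0

lemma binomialMatrix_mul_newtonMatrix (n : ℕ) :
    binomialMatrix n * newtonMatrix n = adaptedMatrix n := by
  ext s j
  rw [Matrix.mul_apply, adaptedMatrix, Matrix.of_apply,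
    eval_eq_sum_choose (d := 2 * n) (q := 2 * n + 3)
      (by rw [natDegree_adaptedPoly]; have := j.2; omega)
      (fun a ha => adaptedPoly_eval_eq_zero n j ha), fwdDiff_iter_finsetSum, Finset.sum_apply,
    Finset.sum_range]
  refine Finset.sum_congr rfl fun i _ => ?_
  rw [fwdDiff_iter_const_smul, Pi.smul_apply, fwdDiff_iter_choose_apply, smul_eq_mul, mul_comm]
  rfl

/-- Column `j` comes from a monic polynomial of degree `2 n + j`: higher differences vanish, and the
difference of that order is its factorial. -/
lemma det_newtonMatrix (n : ℕ) :
    (newtonMatrix n).det = ∏ j ∈ Finset.range (2 * n + 3), ((2 * n + j).factorial : ℚ) := by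
  rw [Matrix.det_of_isUpperTriangular, Finset.prod_range]
  · refine Finset.prod_congr rfl fun j _ => ?_
    have h := fwdDiff_iter_degree_eq_factorial (adaptedPoly n j)
    rw [natDegree_adaptedPoly, (monic_adaptedPoly n j).leadingCoeff, one_smul] at h
    rw [newtonMatrix, Matrix.of_apply, fwdDiff_iter_eval_natCast, h]
    simp
  · intro i j hij
    have hij' : j < i := hij
    rw [newtonMatrix, Matrix.of_apply, fwdDiff_iter_eval_natCast,
      fwdDiff_iter_eq_zero_of_degree_lt]
    · rfl
    · rw [natDegree_adaptedPoly]
      have := Fin.lt_def.1 hij'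
      omega

/-- The polynomial vanishes at the first `min j (2 n)` points from `4 n + 3` on, so at most the last
sample of the difference survives. -/
lemma fwdDiff_adaptedPoly_top (n j t : ℕ) (ht : t < 2 * n) (htj : t ≤ j) :
    Δ_[1] ^[t] (fun y : ℕ => (adaptedPoly n j).eval (y : ℚ)) (4 * n + 3) =
      if t = j then ((4 * n + 3 + t).descFactorial (2 * n) * t.factorial : ℚ) else 0 := by
  have hlt : ∀ s, s < j → s < 2 * n → (adaptedPoly n j).eval ((4 * n + 3 + s : ℕ) : ℚ) = 0 := by
    intro s hs hs'
    rw [adaptedPoly_eval_add, Nat.descFactorial_eq_zero_iff_lt.2 (by omega : s < min j (2 * n))]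
    simp
  rw [fwdDiff_iter_eq_sum, Finset.sum_range_succ, Finset.sum_eq_zero, zero_add]
  · split_ifs with h
    · subst h
      rw [adaptedPoly_eval_add, min_eq_left ht.le, Nat.descFactorial_self,
        Nat.sub_eq_zero_of_le ht.le]
      simp
    · rw [hlt t (by omega) ht, mul_zero]
  · intro s hs
    rw [Finset.mem_range] at hs
    rw [hlt s (by omega) (by omega), mul_zero]

lemma abs_det_adaptedMatrix (n : ℕ) :
    |((adaptedMatrix n).submatrix id finSumFinEquiv).det| =
      (∏ t ∈ Finset.range (2 * n), ((4 * n + 3 + t).descFactorial (2 * n) * t.factorial : ℚ)) *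
        (2 * (3 * n + 1) * (3 * n + 1).descFactorial (2 * n) ^ 2 * centralSum n 1 ^ 2) := by
  set F := (adaptedMatrix n).submatrix id finSumFinEquiv with hF
  have h12 : F.toBlocks₁₂ = 0 := by
    ext t k
    have := fwdDiff_adaptedPoly_top n (2 * n + k) t t.2 (by omega)
    rw [if_neg (by omega)] at this
    simpa [hF, adaptedMatrix, sinkPoint, Matrix.toBlocks₁₂] using this
  have h11 : F.toBlocks₁₁.det =
      ∏ t ∈ Finset.range (2 * n), ((4 * n + 3 + t).descFactorial (2 * n) * t.factorial : ℚ) := by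
    rw [Matrix.det_of_isLowerTriangular, Finset.prod_range]
    · refine Finset.prod_congr rfl fun t _ => ?_
      have := fwdDiff_adaptedPoly_top n t t t.2 le_rfl
      rw [if_pos rfl] at this
      simpa [hF, adaptedMatrix, sinkPoint, Matrix.toBlocks₁₁] using this
    · intro t j htj
      have htj' : t < j := htj
      have := fwdDiff_adaptedPoly_top n j t t.2 (Fin.lt_def.1 htj').le
      rw [if_neg (Fin.lt_def.1 htj').ne] at this
      simpa [hF, adaptedMatrix, sinkPoint, Matrix.toBlocks₁₁] using this
  have h0 : ∀ k, F.toBlocks₂₂ 0 k = (-1) ^ k.val * centralSum n k := fun k => by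
    have := fwdDiff_adaptedPoly_bottom n k
    simpa [hF, adaptedMatrix, sinkPoint, Matrix.toBlocks₂₂] using this
  have h1 : ∀ k, F.toBlocks₂₂ 1 k =
      (3 * n + 1).descFactorial (2 * n) ^ 2 * 0 ^ k.val := fun k => by
    have := adaptedPoly_eval_special n k (y := 3 * n + 1) (y' := 3 * n + 1) (by omega)
    rw [sub_self, ← sq] at this
    simpa [hF, adaptedMatrix, sinkPoint, Matrix.toBlocks₂₂] using this
  have h2 : ∀ k, F.toBlocks₂₂ 2 k = (-1) ^ (3 * n + 1) * centralSum n k := fun k => by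
    have := fwdDiff_adaptedPoly_right n k
    simpa [hF, adaptedMatrix, sinkPoint, Matrix.toBlocks₂₂] using this
  -- The middle row has a single nonzero entry, and in the minor left over the signs `(-1) ^ k` make
  -- the two products add up, whence the factor `2`.
  have h22 : F.toBlocks₂₂.det = (-1) ^ (3 * n + 1) *
      (2 * (3 * n + 1) * (3 * n + 1).descFactorial (2 * n) ^ 2 * centralSum n 1 ^ 2) := by
    rw [Matrix.det_fin_three]
    simp only [h0, h1, h2, Fin.val_zero, Fin.val_one, Fin.val_two, centralSum_two]
    ring
  rw [← Matrix.fromBlocks_toBlocks F, h12, Matrix.det_fromBlocks_zero₁₂, h11, h22, abs_mul,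
    abs_mul, abs_pow, abs_neg, abs_one, one_pow, one_mul, abs_of_nonneg, abs_of_nonneg]
  · positivity
  · exact Finset.prod_nonneg fun _ _ => by positivity

/-- The rows of the matrix that counts the tilings, preceded by the lower removed triangle. -/
def sinkOrder (n : ℕ) : Fin (2 * n + 3) → Fin (2 * n) ⊕ Fin 3 :=
  Fin.cons (Sum.inr 0) (Fin.cons (α := fun _ => Fin (2 * n) ⊕ Fin 3) (Sum.inr 1)
    (Fin.snoc (α := fun _ => Fin (2 * n) ⊕ Fin 3) Sum.inl (Sum.inr 2)))

lemma sinkOrder_bijective (n : ℕ) : Function.Bijective (sinkOrder n) := by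
  rw [Fintype.bijective_iff_surjective_and_card]
  refine ⟨?_, by simp⟩
  rintro (r | k)
  · exact ⟨r.castSucc.succ.succ, by simp [sinkOrder]⟩
  · fin_cases k
    · exact ⟨0, rfl⟩
    · exact ⟨1, rfl⟩
    · exact ⟨(Fin.last _).succ.succ, by simp [sinkOrder]⟩

lemma binomialMatrix_sinkOrder (n : ℕ) (r : Fin (2 * n + 2)) (j : Fin (2 * n + 3)) :
    binomialMatrix n (sinkOrder n r.succ) j = sinkWeight n (3 * n + 1) r ((2 * n + j : ℕ) : ℤ) := by
  revert r
  refine sink_cases ?_ ?_ fun r => ?_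
  · simp [sinkOrder, binomialMatrix, sinkPoint, sinkWeight]
  · rw [sinkWeight_last]
    simp [sinkOrder, binomialMatrix, sinkPoint]
  · rw [sinkWeight_mid, show n + 2 + (3 * n + 1) = 4 * n + 3 by ring]
    simp [sinkOrder, binomialMatrix, sinkPoint]

/-- The difference of order `3 n + 1` at `0` reads off one Newton coefficient, so the first row is
the unit vector at column `n + 1`. Expanding along it deletes exactly the middle bottom position. -/
lemma abs_det_sinkWeight (n : ℕ) :
    |(Matrix.of fun r j => sinkWeight n (3 * n + 1) r (bottomPosition n j)).det| =
      |((binomialMatrix n).submatrix (sinkOrder n) id).det| := by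
  let c : Fin (2 * n + 3) := ⟨n + 1, by omega⟩
  rw [Matrix.det_succ_row_zero (n := 2 * n + 2), Finset.sum_eq_single c]
  · have h : (binomialMatrix n).submatrix (sinkOrder n) id 0 c = 1 := by
      have : ((2 * n + (n + 1) : ℕ) : ℤ) - (3 * n + 1 : ℕ) = 0 := by push_cast; ring
      simp only [Matrix.submatrix_apply, binomialMatrix, sinkOrder, Fin.cons_zero, Matrix.of_apply,
        sinkPoint, Sum.elim_inr, Matrix.cons_val_zero, id, c, this]
      simp [intChoose]
    rw [h, mul_one, abs_mul, abs_pow, abs_neg, abs_one, one_pow, one_mul]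
    congr 2
    ext r j
    have hj : 2 * n + (c.succAbove j).val = bottomPosition n j := by
      rw [bottomPosition, Fin.succAbove]
      simp only [Fin.lt_def, Fin.val_castSucc, c]
      split_ifs
      · simp
      · simp
        omega
    rw [Matrix.submatrix_apply, Matrix.submatrix_apply, id, binomialMatrix_sinkOrder, hj]
    rfl
  · intro j _ hj
    have h : (binomialMatrix n).submatrix (sinkOrder n) id 0 j = 0 := by
      simp only [Matrix.submatrix_apply, binomialMatrix, sinkOrder, Fin.cons_zero, Matrix.of_apply,
        sinkPoint, Sum.elim_inr, Matrix.cons_val_zero, id]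
      rw [intChoose_zero, if_neg]
      have := Fin.val_ne_iff.2 hj
      simp only [c] at this
      push_cast
      omega
    rw [h]
    ring
  · simp

/-- Determinants are taken in `binomialMatrix_mul_newtonMatrix`; the reordering of rows and columns
affects only the sign. -/
theorem abs_det_sinkWeight_mul_prod (n : ℕ) :
    |(Matrix.of fun r j => sinkWeight n (3 * n + 1) r (bottomPosition n j)).det| *
        ∏ j ∈ Finset.range (2 * n + 3), ((2 * n + j).factorial : ℚ) =
      (∏ t ∈ Finset.range (2 * n), ((4 * n + 3 + t).descFactorial (2 * n) * t.factorial : ℚ)) *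
        (2 * (3 * n + 1) * (3 * n + 1).descFactorial (2 * n) ^ 2 * centralSum n 1 ^ 2) := by
  have hpos : 0 ≤ ∏ j ∈ Finset.range (2 * n + 3), ((2 * n + j).factorial : ℚ) :=
    Finset.prod_nonneg fun _ _ => by positivity
  let e := Equiv.ofBijective _ (sinkOrder_bijective n)
  have hprod : (binomialMatrix n).submatrix (sinkOrder n) id * newtonMatrix n =
      ((adaptedMatrix n).submatrix id finSumFinEquiv).submatrix e finSumFinEquiv.symm := by
    rw [← binomialMatrix_mul_newtonMatrix]
    ext i j
    simp [Matrix.mul_apply, e]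
  rw [abs_det_sinkWeight, ← abs_of_nonneg hpos, ← det_newtonMatrix, ← abs_mul, ← Matrix.det_mul,
    hprod, Matrix.abs_det_submatrix_equiv_equiv, abs_det_adaptedMatrix]

end DeterminantEvaluation

/-! ### Factorial bookkeeping and the conclusion -/

lemma choose_mul_factorial_eq (n : ℕ) : (3 * n + 2).choose n * (2 * n + 2).factorial =
    (3 * n + 2) * (n + 1) * (3 * n + 1).descFactorial (2 * n) := by
  have h1 := Nat.choose_mul_factorial_mul_factorial (show n ≤ 3 * n + 2 by omega)
  have h2 := Nat.factorial_mul_descFactorial (show 2 * n ≤ 3 * n + 1 by omega)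
  rw [show 3 * n + 2 - n = 2 * n + 2 by omega, Nat.factorial_succ (3 * n + 1), ← h2,
    show 3 * n + 1 - 2 * n = n + 1 by omega, Nat.factorial_succ n] at h1
  refine Nat.eq_of_mul_eq_mul_right n.factorial_pos ?_
  linear_combination h1

/-- Each product of shifted factorials is a quotient of two products of initial factorials; the
falling factorials are quotients of factorials `2 n` apart. -/
lemma superfactorial_quotient (n : ℕ) :
    (∏ t ∈ Finset.range (2 * n), ((4 * n + 3 + t).descFactorial (2 * n) * t.factorial : ℚ)) *
        (∏ k ∈ Finset.range (4 * n + 3), (k.factorial : ℚ)) ^ 3 =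
      (∏ j ∈ Finset.range (2 * n + 3), ((2 * n + j).factorial : ℚ)) *
        ((∏ k ∈ Finset.range (2 * n), (k.factorial : ℚ)) ^ 3 *
          ((2 * n).factorial * (2 * n + 1).factorial * (2 * n + 2).factorial) *
          ∏ k ∈ Finset.range (6 * n + 3), (k.factorial : ℚ)) := by
  have h1 := Finset.prod_range_add (fun k => (k.factorial : ℚ)) (2 * n) (2 * n + 3)
  have h2 := Finset.prod_range_add (fun k => (k.factorial : ℚ)) (4 * n + 3) (2 * n)
  have h3 := Finset.prod_range_add (fun k => (k.factorial : ℚ)) (2 * n + 3) (2 * n)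
  have h4 : (∏ t ∈ Finset.range (2 * n), ((2 * n + 3 + t).factorial : ℚ)) *
      ∏ t ∈ Finset.range (2 * n), ((4 * n + 3 + t).descFactorial (2 * n) : ℚ) =
      ∏ t ∈ Finset.range (2 * n), ((4 * n + 3 + t).factorial : ℚ) := by
    rw [← Finset.prod_mul_distrib]
    refine Finset.prod_congr rfl fun t _ => ?_
    have := Nat.factorial_mul_descFactorial (show 2 * n ≤ 4 * n + 3 + t by omega)
    rw [show 4 * n + 3 + t - 2 * n = 2 * n + 3 + t by omega] at this
    exact_mod_cast this
  have h5 : ∏ k ∈ Finset.range (2 * n + 3), (k.factorial : ℚ) =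
      (∏ k ∈ Finset.range (2 * n), (k.factorial : ℚ)) *
        ((2 * n).factorial * (2 * n + 1).factorial * (2 * n + 2).factorial) := by
    rw [Finset.prod_range_succ, Finset.prod_range_succ, Finset.prod_range_succ]
    ring
  rw [show 2 * n + (2 * n + 3) = 4 * n + 3 by ring] at h1
  rw [show 4 * n + 3 + 2 * n = 6 * n + 3 by ring] at h2
  rw [show 2 * n + 3 + 2 * n = 4 * n + 3 by ring, h5] at h3
  rw [Finset.prod_mul_distrib, h2, ← h4]
  set S4 := ∏ k ∈ Finset.range (4 * n + 3), (k.factorial : ℚ)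
  set S2 := ∏ k ∈ Finset.range (2 * n), (k.factorial : ℚ)
  set P1 := ∏ j ∈ Finset.range (2 * n + 3), ((2 * n + j).factorial : ℚ)
  set P3 := ∏ t ∈ Finset.range (2 * n), ((2 * n + 3 + t).factorial : ℚ)
  set G := ∏ t ∈ Finset.range (2 * n), ((4 * n + 3 + t).descFactorial (2 * n) : ℚ)
  linear_combination (G * S2 * S4 ^ 2) * h1 + (G * S2 * S4 * (S2 * P1)) * h3

theorem corollary2 (n : ℕ) :
    ({T : Set (Finset UnitTriangle) | IsRhombusTiling (incompleteHexagon n) T}.ncard : ℚ) =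
      ((Nat.ascFactorial (n + 2) (2 * n) : ℕ) : ℚ) ^ 6 *
        ((∏ k ∈ Finset.range (2 * n + 1), (Nat.factorial k : ℚ)) ^ 3 *
            (∏ k ∈ Finset.range (6 * n + 3), (Nat.factorial k : ℚ)) /
          (∏ k ∈ Finset.range (4 * n + 3), (Nat.factorial k : ℚ)) ^ 3) *
        ((n : ℚ) + 1) ^ 3 * (3 * (n : ℚ) + 1) * (3 * (n : ℚ) + 2) ^ 2 := by
  have hprod := abs_det_sinkWeight_mul_prod n
  rw [← tilingCount_incompleteHexagon, Nat.abs_cast, centralSum_one_sq] at hprod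
  change (tilingCount (incompleteHexagon n) : ℚ) = _
  have hpos : ∀ (s : Finset ℕ) (f : ℕ → ℕ), ∏ k ∈ s, ((f k).factorial : ℚ) ≠ 0 := fun s f =>
    Finset.prod_ne_zero_iff.2 fun k _ => by positivity
  have hasc : (n + 2).ascFactorial (2 * n) = (3 * n + 1).descFactorial (2 * n) := by
    rw [← Nat.add_descFactorial_eq_ascFactorial, show n + 1 + 2 * n = 3 * n + 1 by ring]
  have hchoose : ((3 * n + 2).choose n : ℚ) * (2 * n + 2).factorial =
      (3 * n + 2) * (n + 1) * (3 * n + 1).descFactorial (2 * n) := by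
    exact_mod_cast choose_mul_factorial_eq n
  have hfac : ((2 * n + 2).factorial : ℚ) = (2 * n + 2) * (2 * n + 1).factorial := by
    rw [Nat.factorial_succ (2 * n + 1)]
    push_cast
    ring
  have hquot := superfactorial_quotient n
  have h4 := hpos (Finset.range (4 * n + 3)) fun k => k
  have h1 := hpos (Finset.range (2 * n + 3)) fun j => 2 * n + j
  rw [hasc, Finset.prod_range_succ _ (2 * n), mul_div_assoc', div_mul_eq_mul_div,
    div_mul_eq_mul_div, div_mul_eq_mul_div, eq_div_iff (pow_ne_zero 3 h4)]
  refine mul_left_cancel₀ h1 ?_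
  set S4 := ∏ k ∈ Finset.range (4 * n + 3), (k.factorial : ℚ)
  set S2 := ∏ k ∈ Finset.range (2 * n), (k.factorial : ℚ)
  set S6 := ∏ k ∈ Finset.range (6 * n + 3), (k.factorial : ℚ)
  set P1 := ∏ j ∈ Finset.range (2 * n + 3), ((2 * n + j).factorial : ℚ)
  set X : ℚ := ((3 * n + 1).descFactorial (2 * n) : ℚ)
  set c : ℚ := ((3 * n + 2).choose n : ℚ)
  set f0 : ℚ := ((2 * n).factorial : ℚ)
  set f1 : ℚ := ((2 * n + 1).factorial : ℚ)
  set f2 : ℚ := ((2 * n + 2).factorial : ℚ)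
  set N : ℚ := (n : ℚ)
  -- The factor `2 * (N + 1) * f1` equals `f2` by `hfac`, which creates the square of `c * f2` that
  -- `hchoose` evaluates.
  have key : f0 * f1 * f2 * (2 * (3 * N + 1) * X ^ 2 * (f0 * X * (N + 1) * c) ^ 2) =
      X ^ 6 * f0 ^ 3 * (N + 1) ^ 3 * (3 * N + 1) * (3 * N + 2) ^ 2 := by
    have hsq : (c * f2) ^ 2 = ((3 * N + 2) * (N + 1) * X) ^ 2 := by rw [hchoose]
    linear_combination (f0 ^ 3 * (3 * N + 1) * X ^ 4 * (N + 1)) * hsq -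
      (f0 ^ 3 * f2 * c ^ 2 * (3 * N + 1) * X ^ 4 * (N + 1)) * hfac
  linear_combination S4 ^ 3 * hprod +
    (2 * (3 * N + 1) * X ^ 2 * (f0 * X * (N + 1) * c) ^ 2) * hquot + P1 * S2 ^ 3 * S6 * key
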